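/- Let $A,B$ be $d\times d$ matrices with non-negative entries, and let $(X_t)_{t\ge 0}$ ($\mathbb N_0^d$-valued counts), $(\lambda_t)_{t\ge 0}$ and $(Z_t)_{t\ge 0}$ (both $[0,\infty)^d$-valued) be processes on a probability space $(\Omega,\mathcal F,P)$. Put $\mathcal F_s=\sigma(\lambda_0,X_0,Z_0,\dots,X_s,Z_s)$ and suppose that they form a $d$-variate Poisson-INGARCH(1,1) model, that is, for all $t\ge 1$, $$X_t\mid\mathcal F_{t-1}\sim \mathrm{Poi}(\lambda_t),\qquad \lambda_t=A\lambda_{t-1}+BX_{t-1}+Z_{t-1}\quad\text{almost surely},$$ where $\mathrm{Poi}(\lambda)$ is the law on $\mathbb N_0^d$ with independent Poisson components of intensities $\lambda_1,\dots,\lambda_d$, the covariates $Z_0,Z_1,\dots$ are independent, and $Z_t$ is independent of $\sigma(\mathcal F_{t-1},X_t)$ for every $t\ge1$. (The covariates need not be identically distributed, and may be explosive.) Let $\sqrt{\cdot}$ act entrywise on matrices, let $\rho(M)$ be the spectral radius of a matrix $M$, and assume (i) $\rho(\sqrt A+2\sqrt B)<1$; (ii) $E\sqrt{\lambda_{0,i}}<\infty$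 and $E\sqrt{X_{0,i}}<\infty$ for $i=1,\dots,d$ (the second condition follows from the first if $X_0\mid\lambda_0\sim\mathrm{Poi}(\lambda_0)$); (iii) $E\sqrt{Z_{t,i}}<\infty$ for all $t\ge 0$, and $\sup_{t\ge 0}E\big|\sqrt{Z_{t,i}}-E\sqrt{Z_{t,i}}\big|<\infty$, for $i=1,\dots,d$. For sub-$\sigma$-algebras $\mathcal A_1,\mathcal A_2$ let $\beta(\mathcal A_1,\mathcal A_2)=E\big[\operatorname{ess\,sup}_{C\in\mathcal A_2}|P(C\mid\mathcal A_1)-P(C)|\big]$, and let $$\beta^X(n)=\sup_{k\ge 0}\beta\big(\sigma(X_0,\dots,X_k),\sigma(X_{k+n},X_{k+n+1},\dots)\big).$$ Then the count process $(X_t)_{t\ge0}$ is absolutely regular, i.e. $\beta^X(n)\to0$ as $n\to\infty$, and for every $\kappa>\rho(\sqrt A+2\sqrt B)$ one has $\beta^X(n)=O(\kappa^n)$, i.e. there is a constant $K<\infty$ with $\beta^X(n)\le K\kappa^n$ for all $n\ge 0$. -/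

import Mathlib

open MeasureTheory ProbabilityTheory Filter Topology
open scoped NNReal ENNReal Matrix

noncomputable section

/-! ### Coefficients of absolute regularity -/

/-- The coefficient of absolute regularity
`β(𝒜₁, 𝒜₂) = E [ sup { |P(B ∣ 𝒜₁) - P(B)| : B ∈ 𝒜₂ } ]`.
Each `P(B ∣ 𝒜₁)` is a random variable defined up to null sets only, so the supremum over the
(in general uncountable) family is the essential supremum, i.e. the almost surely least
measurable `g` that dominates every member of the family almost surely. Its expectation is the
least expectation of a measurable function `g` with this domination property. -/
def betaCoeff {Ω : Type*} (m₁ m₂ : MeasurableSpace Ω) [mΩ : MeasurableSpace Ω] (μ : Measure Ω) :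
    ℝ≥0∞ :=
  ⨅ (g : Ω → ℝ≥0∞) (_ : Measurable[mΩ] g)
    (_ : ∀ B : Set Ω, MeasurableSet[m₂] B →
      ∀ᵐ ω ∂μ, ENNReal.ofReal |(μ[B.indicator (fun _ => (1 : ℝ)) | m₁]) ω - μ.real B| ≤ g ω),
    ∫⁻ ω, g ω ∂μ

/-- `σ(X_0, …, X_k)`. -/
@[reducible] def pastSigma {Ω E : Type*} [MeasurableSpace E] (X : ℕ → Ω → E) (k : ℕ) : MeasurableSpace Ω :=
  ⨆ j : ℕ, ⨆ _ : j ≤ k, MeasurableSpace.comap (X j) inferInstance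

/-- `σ(X_m, X_{m+1}, …)`. -/
@[reducible] def futureSigma {Ω E : Type*} [MeasurableSpace E] (X : ℕ → Ω → E) (m : ℕ) : MeasurableSpace Ω :=
  ⨆ j : ℕ, ⨆ _ : m ≤ j, MeasurableSpace.comap (X j) inferInstance

/-- `β^X(k, n) = β(σ(X_0, …, X_k), σ(X_{k+n}, X_{k+n+1}, …))`. -/
def betaAt {Ω E : Type*} [MeasurableSpace Ω] [MeasurableSpace E] (μ : Measure Ω)
    (X : ℕ → Ω → E) (k n : ℕ) : ℝ≥0∞ :=
  betaCoeff (pastSigma X k) (futureSigma X (k + n)) μ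

/-- `β^X(n) = sup_k β^X(k, n)`. -/
def betaMixing {Ω E : Type*} [MeasurableSpace Ω] [MeasurableSpace E] (μ : Measure Ω)
    (X : ℕ → Ω → E) (n : ℕ) : ℝ≥0∞ :=
  ⨆ k : ℕ, betaAt μ X k n

/-- A process is absolutely regular (`β`-mixing) if `β^X(n) → 0`. -/
def AbsolutelyRegular {Ω E : Type*} [MeasurableSpace Ω] [MeasurableSpace E] (μ : Measure Ω)
    (X : ℕ → Ω → E) : Prop :=
  Tendsto (betaMixing μ X) atTop (𝓝 0)

/-! ### The multivariate Poisson-INGARCH(1,1) model -/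

/-- `Poi(l)`: the law on `ℕ^d` with independent components, the `i`-th being Poisson with
intensity `l i`. -/
def poissonVec {d : ℕ} (l : Fin d → ℝ≥0) : Measure (Fin d → ℕ) :=
  Measure.pi fun i => poissonMeasure (l i)

/-- `ℱ_s = σ(lam_0, X_0, Z_0, …, X_s, Z_s)`. -/
@[reducible] def history {Ω : Type*} {d : ℕ} (lam : ℕ → Ω → Fin d → ℝ≥0) (X : ℕ → Ω → Fin d → ℕ)
    (Z : ℕ → Ω → Fin d → ℝ≥0) (s : ℕ) : MeasurableSpace Ω :=
  MeasurableSpace.comap (lam 0) inferInstance ⊔ pastSigma X s ⊔ pastSigma Z s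

/-- The `d`-variate Poisson-INGARCH(1,1) model with intensities `lam`, counts `X`, covariates `Z`
and coefficient matrices `A`, `B` with non-negative entries: for all `t ≥ 1`,
`X_t ∣ ℱ_{t-1} ∼ Poi(lam_t)` and `lam_t = A lam_{t-1} + B X_{t-1} + Z_{t-1}`; the covariates are
independent, and `Z_t` is independent of `σ(ℱ_{t-1}, X_t)`. -/
structure IsPoissonINGARCH {Ω : Type*} [MeasurableSpace Ω] (μ : Measure Ω) {d : ℕ}
    (A B : Matrix (Fin d) (Fin d) ℝ≥0) (lam : ℕ → Ω → Fin d → ℝ≥0) (X : ℕ → Ω → Fin d → ℕ)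
    (Z : ℕ → Ω → Fin d → ℝ≥0) : Prop where
  measurable_lam : ∀ t, Measurable (lam t)
  measurable_X : ∀ t, Measurable (X t)
  measurable_Z : ∀ t, Measurable (Z t)
  condLaw : ∀ t : ℕ, ∀ C : Set (Fin d → ℕ), MeasurableSet C →
    μ[(X (t + 1) ⁻¹' C).indicator (fun _ => (1 : ℝ)) | history lam X Z t]
      =ᵐ[μ] fun ω => (poissonVec (lam (t + 1) ω)).real C
  recursion : ∀ t : ℕ, ∀ᵐ ω ∂μ,
    lam (t + 1) ω = A *ᵥ lam t ω + B *ᵥ (fun j => (X t ω j : ℝ≥0)) + Z t ω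
  iIndep_Z : iIndepFun Z μ
  indep_Z : ∀ t : ℕ, Indep (MeasurableSpace.comap (Z (t + 1)) inferInstance)
    (history lam X Z t ⊔ MeasurableSpace.comap (X (t + 1)) inferInstance) μ

/-- The matrix `√A + 2√B` (entrywise square roots), viewed over `ℂ`. -/
def sqrtMatrix {d : ℕ} (A B : Matrix (Fin d) (Fin d) ℝ≥0) : Matrix (Fin d) (Fin d) ℂ :=
  Matrix.of fun i j => ((√(A i j : ℝ) + 2 * √(B i j : ℝ) : ℝ) : ℂ)

/-- `ρ(√A + 2√B)`: the maximal modulus of the complex eigenvalues of `√A + 2√B`. -/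
def rhoSqrt {d : ℕ} (A B : Matrix (Fin d) (Fin d) ℝ≥0) : ℝ≥0∞ :=
  spectralRadius ℂ (sqrtMatrix A B)

end

/-! Everything is measured in the distance |√l - √l'|, summed or weighted over coordinates. On this
scale (a, b) ↦ √(a + b) is 1-Lipschitz, so the recursion acts through the matrices √A and √B, and
Poisson laws behave well. For 0 ≤ h ≤ 1, F(l) = E h(N) with N ~ Poi(l) has derivative E[h(N+1) -
h(N)]. This is at most 1/√l in modulus in general, and at most v/√l if h is v-Lipschitz in √n. Since
2v√l is a primitive of v/√l, changing l to l' costs at most 2|√l - √l'| in total variation, and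
averaging turns the constant v into 2v. This is the origin of the 2 in M = √A + 2√B.

Given the history up to time k, the probability of an event about the counts in a window from time
k+1+j on is a function V of the intensity at time k+1, because the covariates are independent
(`IsPoissonINGARCH.lintegral_mul_truncPath`). Backward induction bounds the Lipschitz weights of V.
Inside the window each step pays a total variation price 2 and multiplies the later weights by at
most M (`condValue_le_add`). Before the window the counts are unobserved, and each step only
multiplies by M (`condValue_le_add_contraction`). The weights are thus a tail of the series ∑
2·1ᵀMⁱ, of order κ^j uniformly in the window length, by Gelfand's formula.

Comparing V(λ_{k+1}) with its value at a deterministic point c bounds the mixing defect by the mean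
distance of λ_{k+1} from c. Explosive covariates may drive λ to infinity, but its distance from a
moving deterministic centre stays bounded in mean (`exists_bound_lintegral_sqrtDist_centre`). -/

noncomputable section

/-! ### One-dimensional Poisson laws -/

/-- The Poisson weights, as functions of a real intensity. -/
def poissonWeight (l : ℝ) (n : ℕ) : ℝ := Real.exp (-l) * l ^ n / (n.factorial : ℝ)

lemma poissonWeight_nonneg {l : ℝ} (hl : 0 ≤ l) (n : ℕ) : 0 ≤ poissonWeight l n := by
  unfold poissonWeight; positivity

lemma hasSum_poissonWeight {l : ℝ} (hl : 0 ≤ l) : HasSum (poissonWeight l) 1 :=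
  hasSum_one_poissonMeasure ⟨l, hl⟩

lemma poissonWeight_succ_mul (l : ℝ) (n : ℕ) :
    poissonWeight l (n + 1) * ((n + 1 : ℕ) : ℝ) = l * poissonWeight l n := by
  unfold poissonWeight
  have : (n.factorial : ℝ) ≠ 0 := by positivity
  rw [Nat.factorial_succ]
  push_cast
  field_simp
  ring

/-- The Stein–Chen identity E[N f(N)] = l E[f(N+1)], source of the Poisson moments and of the bound
on F' below. -/
lemma hasSum_poissonWeight_mul_nat {l s : ℝ} {f : ℕ → ℝ}
    (h : HasSum (fun n => poissonWeight l n * f (n + 1)) s) :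
    HasSum (fun n => poissonWeight l n * (n * f n)) (l * s) := by
  have h1 := h.mul_left l
  rw [← hasSum_nat_add_iff' 1]
  simp only [Finset.range_one, Finset.sum_singleton, Nat.cast_zero, zero_mul, mul_zero, sub_zero]
  convert! h1 using 2 with n
  rw [← mul_assoc, poissonWeight_succ_mul, mul_assoc]

lemma hasSum_poissonWeight_sq_sub {l : ℝ} (hl : 0 ≤ l) :
    HasSum (fun n => poissonWeight l n * ((n : ℝ) - l) ^ 2) l := by
  have h0 := hasSum_poissonWeight hl
  have h1 : HasSum (fun n => poissonWeight l n * ((n : ℝ) * 1)) (l * 1) :=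
    hasSum_poissonWeight_mul_nat (f := fun _ => 1) (by simpa using h0)
  have h2 : HasSum (fun n => poissonWeight l n * ((n : ℝ) * (n : ℝ))) (l * (l * 1 + 1)) := by
    refine hasSum_poissonWeight_mul_nat (f := fun n => (n : ℝ)) ?_
    convert! h1.add h0 using 2 with n
    push_cast; ring
  convert! (h2.sub (h1.mul_left (2 * l))).add (h0.mul_left (l ^ 2)) using 1
  · ext n; ring
  · ring

/-- The inequality y ≤ (1 + y²)/2 at y = |x - l|/√l. Under Poi(l) the last factor has mean 1, as the
variance is l, so this replaces Cauchy–Schwarz. -/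
lemma abs_sub_div_le {l : ℝ} (hl : 0 < l) (x : ℝ) :
    |x - l| / l ≤ 1 / √l * (1 / 2 * (1 + (x - l) ^ 2 / l)) := by
  have hs : 0 < √l := Real.sqrt_pos.2 hl
  have hss : √l * √l = l := Real.mul_self_sqrt hl.le
  set s := √l
  rw [← hss, ← sq_abs]
  have : 0 ≤ (|x - s * s| - s) ^ 2 := sq_nonneg _
  rw [div_le_iff₀ (by positivity)]
  have h2 : 1 / s * (1 / 2 * (1 + |x - s * s| ^ 2 / (s * s))) * (s * s)
    = (s ^ 2 + |x - s * s| ^ 2) / (2 * s) := by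
    field_simp
  rw [h2, le_div_iff₀ (by positivity)]
  nlinarith

lemma hasSum_poissonWeight_deviation {l : ℝ} (hl : 0 < l) :
    HasSum (fun n => poissonWeight l n * (1 / 2 * (1 + ((n : ℝ) - l) ^ 2 / l))) 1 := by
  convert! ((hasSum_poissonWeight hl.le).add
    ((hasSum_poissonWeight_sq_sub hl.le).div_const l)).mul_left (1 / 2) using 1
  · ext n; ring
  · field_simp; norm_num

/-- The expectation of a bounded function of a Poisson variable is differentiable in the
intensity, the derivative being the expectation of the forward difference. -/
lemma hasDerivAt_tsum_poissonWeight {h : ℕ → ℝ} (h0 : ∀ n, 0 ≤ h n) (h1 : ∀ n, h n ≤ 1) (l : ℝ) :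
    HasDerivAt (fun l => ∑' n, poissonWeight l n * h n)
      (∑' n, poissonWeight l n * h (n + 1) - ∑' n, poissonWeight l n * h n) l := by
  have habs : ∀ n, |h n| ≤ 1 := fun n => abs_le.2 ⟨by linarith [h0 n], h1 n⟩
  set R := |l| + 1
  have hR : 0 ≤ R := by positivity
  have hsum : ∀ (f : ℕ → ℝ), (∀ n, |f n| ≤ 1) → ∀ x : ℝ,
      Summable fun n => x ^ n / (n.factorial : ℝ) * f n := by
    intro f hf x
    refine Summable.of_norm_bounded (Real.summable_pow_div_factorial |x|) fun n => ?_
    rw [Real.norm_eq_abs, abs_mul, abs_div, abs_pow, Nat.abs_cast]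
    exact mul_le_of_le_one_right (by positivity) (hf n)
  -- Without the factor exp(-l) this is a power series, differentiated termwise on a ball containing
  -- `l`. Arbitrary real `l` are allowed, so the endpoint 0 needs no separate treatment.
  have key : HasDerivAt (fun l : ℝ => ∑' n : ℕ, l ^ n / (n.factorial : ℝ) * h n)
      (∑' n : ℕ, (n * l ^ (n - 1)) / (n.factorial : ℝ) * h n) l := by
    refine hasDerivAt_tsum_of_isPreconnected (t := Metric.ball 0 R) (y₀ := 0)
      (g := fun (n : ℕ) (l : ℝ) => l ^ n / (n.factorial : ℝ) * h n)
      (g' := fun (n : ℕ) (l : ℝ) => (n * l ^ (n - 1)) / (n.factorial : ℝ) * h n)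
      (u := fun n : ℕ => (n * R ^ (n - 1)) / (n.factorial : ℝ)) ?_ Metric.isOpen_ball
      (convex_ball _ _).isPreconnected ?_ ?_ (Metric.mem_ball_self (by positivity))
      (hsum h habs 0) (by simp [R])
    · rw [← summable_nat_add_iff 1]
      convert! Real.summable_pow_div_factorial R using 2 with n
      rw [Nat.factorial_succ]; push_cast; field_simp
    · intro n y _
      exact ((hasDerivAt_pow n y).div_const _).mul_const _
    · intro n y hy
      have hy' : |y| ≤ R := by simpa using (Metric.mem_ball.1 hy).le
      rw [Real.norm_eq_abs, abs_mul, abs_div, abs_mul, abs_pow, Nat.abs_cast, Nat.abs_cast]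
      refine (mul_le_of_le_one_right (by positivity) (habs n)).trans ?_
      gcongr
  have hshift : (∑' n : ℕ, (n * l ^ (n - 1)) / (n.factorial : ℝ) * h n)
      = ∑' n : ℕ, l ^ n / (n.factorial : ℝ) * h (n + 1) := by
    have hs := hsum (fun n => h (n + 1)) (fun n => habs _) l
    have : HasSum (fun n : ℕ => (n * l ^ (n - 1)) / (n.factorial : ℝ) * h n)
        (∑' n : ℕ, l ^ n / (n.factorial : ℝ) * h (n + 1)) := by
      rw [← hasSum_nat_add_iff' 1]
      simp only [Finset.range_one, Finset.sum_singleton, Nat.cast_zero, zero_mul, zero_div,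
        sub_zero]
      convert! hs.hasSum using 2 with n
      rw [Nat.factorial_succ]; push_cast; field_simp
    exact this.tsum_eq
  rw [hshift] at key
  have hexp : HasDerivAt (fun l : ℝ => Real.exp (-l)) (-Real.exp (-l)) l := by
    simpa using (hasDerivAt_neg l).exp
  have := hexp.mul key
  have e : ∀ (f : ℕ → ℝ) (x : ℝ), ∑' n, poissonWeight x n * f n
      = Real.exp (-x) * ∑' n : ℕ, x ^ n / (n.factorial : ℝ) * f n := by
    intro f x
    rw [← tsum_mul_left]
    congr with n
    unfold poissonWeight; ring
  simp_rw [e]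
  convert! this using 1
  ring

lemma summable_poissonWeight_mul {l : ℝ} (hl : 0 ≤ l) {h : ℕ → ℝ} (h1 : ∀ n, |h n| ≤ 1) :
    Summable fun n => poissonWeight l n * h n := by
  refine Summable.of_norm_bounded (hasSum_poissonWeight hl).summable fun n => ?_
  rw [Real.norm_eq_abs, abs_mul, abs_of_nonneg (poissonWeight_nonneg hl n)]
  exact mul_le_of_le_one_right (poissonWeight_nonneg hl n) (h1 n)

/-- By Stein–Chen the difference equals E[(N - l)/l · h(N)], and E|N - l|/l ≤ 1/√l. -/
lemma abs_poisson_difference_le {h : ℕ → ℝ} (h0 : ∀ n, 0 ≤ h n) (h1 : ∀ n, h n ≤ 1)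
    {l : ℝ} (hl : 0 < l) :
    |∑' n, poissonWeight l n * h (n + 1) - ∑' n, poissonWeight l n * h n| ≤ 1 / √l := by
  have habs : ∀ n, |h n| ≤ 1 := fun n => abs_le.2 ⟨by linarith [h0 n], h1 n⟩
  have hs1 := (summable_poissonWeight_mul hl.le (h := fun n => h (n + 1)) fun n => habs _).hasSum
  have hs0 := (summable_poissonWeight_mul hl.le habs).hasSum
  have hs2 := ((hasSum_poissonWeight_mul_nat hs1).div_const l).sub hs0
  rw [mul_div_cancel_left₀ _ hl.ne'] at hs2
  have hb := (hasSum_poissonWeight_deviation hl).mul_left (1 / √l)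
  rw [mul_one] at hb
  rw [← hs2.tsum_eq, ← Real.norm_eq_abs]
  refine tsum_of_norm_bounded hb fun n => ?_
  have hp := poissonWeight_nonneg hl.le n
  have : poissonWeight l n * (n * h n) / l - poissonWeight l n * h n
      = poissonWeight l n * (((n : ℝ) - l) / l * h n) := by field_simp
  rw [this, Real.norm_eq_abs, abs_mul, abs_of_nonneg hp, abs_mul, abs_div, abs_of_pos hl]
  calc _ ≤ poissonWeight l n * (|(n : ℝ) - l| / l) := by
        gcongr; exact mul_le_of_le_one_right (by positivity) (habs n)
    _ ≤ poissonWeight l n * (1 / √l * (1 / 2 * (1 + ((n : ℝ) - l) ^ 2 / l))) := by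
        gcongr; exact abs_sub_div_le hl n
    _ = _ := by ring

/-- The increment is at most 1/√(n+1), which the arithmetic-geometric mean inequality makes affine
in 1/(n+1), a quantity with explicit Poisson mean. -/
lemma sqrt_succ_sub_sqrt_le {l : ℝ} (hl : 0 < l) (n : ℕ) :
    √((n + 1 : ℕ) : ℝ) - √(n : ℝ) ≤ 1 / 2 * (√l * (1 / ((n + 1 : ℕ) : ℝ)) + 1 / √l) := by
  have hs : 0 < √l := Real.sqrt_pos.2 hl
  have hm : (0 : ℝ) < ((n + 1 : ℕ) : ℝ) := by positivity
  have ha : 0 < √((n + 1 : ℕ) : ℝ) := Real.sqrt_pos.2 hm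
  have hb : 0 ≤ √(n : ℝ) := Real.sqrt_nonneg _
  have haa : √((n + 1 : ℕ) : ℝ) ^ 2 = n + 1 := by rw [Real.sq_sqrt hm.le]; push_cast; ring
  have hbb : √(n : ℝ) ^ 2 = n := Real.sq_sqrt (Nat.cast_nonneg n)
  rw [← Real.sq_sqrt hm.le]
  set a := √((n + 1 : ℕ) : ℝ)
  set b := √(n : ℝ)
  set s := √l
  have h1 : a - b ≤ 1 / a := by
    rw [le_div_iff₀ ha]
    have : b ≤ a := by nlinarith
    nlinarith
  rw [Real.sqrt_sq ha.le]
  refine h1.trans ?_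
  have e : 1 / 2 * (s * (1 / a ^ 2) + 1 / s) = (s ^ 2 + a ^ 2) / (2 * s * a ^ 2) := by field_simp
  rw [e, div_le_div_iff₀ ha (by positivity)]
  nlinarith [mul_nonneg ha.le (sq_nonneg (s - a))]

/-- Averaging the increments of √n uses E[1/(N+1)] = (1 - e^{-l})/l ≤ 1/l, so both halves of the
previous bound contribute at most 1/(2√l). -/
lemma abs_poisson_difference_le_of_lipschitz {h : ℕ → ℝ} (h0 : ∀ n, 0 ≤ h n)
    (h1 : ∀ n, h n ≤ 1) {v : ℝ} (hv : 0 ≤ v)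
    (hlip : ∀ n : ℕ, |h (n + 1) - h n| ≤ v * (√((n + 1 : ℕ) : ℝ) - √(n : ℝ)))
    {l : ℝ} (hl : 0 < l) :
    |∑' n, poissonWeight l n * h (n + 1) - ∑' n, poissonWeight l n * h n| ≤ v / √l := by
  have habs : ∀ n, |h n| ≤ 1 := fun n => abs_le.2 ⟨by linarith [h0 n], h1 n⟩
  have hs1 := (summable_poissonWeight_mul hl.le (h := fun n => h (n + 1)) fun n => habs _).hasSum
  have hs0 := (summable_poissonWeight_mul hl.le habs).hasSum
  have hs2 := hs1.sub hs0
  have hsq : 0 < √l := Real.sqrt_pos.2 hl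
  have hss : √l * √l = l := Real.mul_self_sqrt hl.le
  have hinv : HasSum (fun n => poissonWeight l n * (1 / ((n + 1 : ℕ) : ℝ)))
      ((1 - poissonWeight l 0) / l) := by
    have := ((hasSum_nat_add_iff' 1).2 (hasSum_poissonWeight hl.le)).div_const l
    simp only [Finset.range_one, Finset.sum_singleton] at this
    convert! this using 2 with n
    have e := poissonWeight_succ_mul l n
    rw [mul_one_div, div_eq_div_iff (by positivity) hl.ne', e, mul_comm]
  have hb := (((hinv.mul_left (√l)).add
    ((hasSum_poissonWeight hl.le).mul_right (1 / √l))).mul_left (1 / 2)).mul_left v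
  rw [← hs2.tsum_eq, ← Real.norm_eq_abs]
  refine (tsum_of_norm_bounded hb fun n => ?_).trans ?_
  · have hp := poissonWeight_nonneg hl.le n
    rw [← mul_sub, Real.norm_eq_abs, abs_mul, abs_of_nonneg hp]
    calc _ ≤ poissonWeight l n * (v * (1 / 2 * (√l * (1 / ((n + 1 : ℕ) : ℝ)) + 1 / √l))) := by
          gcongr
          exact (hlip n).trans (by gcongr; exact sqrt_succ_sub_sqrt_le hl n)
      _ = _ := by ring
  · rw [div_eq_mul_one_div v]
    gcongr
    have hp := poissonWeight_nonneg hl.le 0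
    have : √l * ((1 - poissonWeight l 0) / l) ≤ 1 / √l := by
      rw [← hss] at *
      rw [Real.sqrt_mul_self hsq.le] at *
      rw [mul_div_assoc', div_le_div_iff₀ (by positivity) hsq]
      nlinarith [mul_nonneg hp (mul_pos hsq hsq).le]
    linarith

/-- Since 2v√x is a primitive of v/√x, both 2v√x + F and 2v√x - F are monotone on [0, ∞). -/
lemma sub_le_of_abs_deriv_le_div_sqrt {F F' : ℝ → ℝ} {v : ℝ}
    (hF : ∀ x, HasDerivAt F (F' x) x) (hb : ∀ x, 0 < x → |F' x| ≤ v / √x)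
    {a b : ℝ} (ha : 0 ≤ a) (hab : a ≤ b) : |F b - F a| ≤ 2 * v * (√b - √a) := by
  have key : ∀ σ : ℝ, |σ| ≤ 1 → MonotoneOn (fun x => 2 * v * √x + σ * F x) (Set.Ici 0) := by
    intro σ hσ
    have hd : ∀ x ∈ interior (Set.Ici (0 : ℝ)),
        HasDerivAt (fun x => 2 * v * √x + σ * F x) (2 * v * (1 / (2 * √x)) + σ * F' x) x := by
      intro x hx
      rw [interior_Ici, Set.mem_Ioi] at hx
      exact ((Real.hasDerivAt_sqrt hx.ne').const_mul _).add ((hF x).const_mul _)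
    refine monotoneOn_of_deriv_nonneg (convex_Ici 0) ?_
      (fun x hx => (hd x hx).differentiableAt.differentiableWithinAt) fun x hx => ?_
    · exact ((Real.continuous_sqrt.const_mul _).add
        ((continuous_iff_continuousAt.2 fun x => (hF x).continuousAt).const_mul _)).continuousOn
    · rw [(hd x hx).deriv]
      rw [interior_Ici, Set.mem_Ioi] at hx
      have h1 := hb x hx
      have h2 : |σ * F' x| ≤ v / √x := by
        rw [abs_mul]
        exact (mul_le_of_le_one_left (abs_nonneg _) hσ).trans h1
      have h3 : 2 * v * (1 / (2 * √x)) = v / √x := by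
        have := Real.sqrt_pos.2 hx
        field_simp
      linarith [neg_abs_le (σ * F' x)]
  have k1 := key 1 (by simp) ha (ha.trans hab) hab
  have k2 := key (-1) (by simp) ha (ha.trans hab) hab
  simp only at k1 k2
  rw [abs_le]
  constructor <;> linarith

lemma lintegral_poissonMeasure (l : ℝ≥0) (h : ℕ → ℝ≥0∞) :
    ∫⁻ n, h n ∂(poissonMeasure l) = ∑' n, h n * ENNReal.ofReal (poissonWeight l n) := by
  rw [lintegral_countable']
  simp_rw [poissonMeasure_singleton]
  rfl

lemma toReal_lintegral_poissonMeasure (l : ℝ≥0) {h : ℕ → ℝ≥0∞} (h1 : ∀ n, h n ≤ 1) :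
    (∫⁻ n, h n ∂(poissonMeasure l)).toReal = ∑' n, poissonWeight l n * (h n).toReal := by
  rw [lintegral_poissonMeasure, ENNReal.tsum_toReal_eq]
  · congr with n
    rw [ENNReal.toReal_mul, ENNReal.toReal_ofReal (poissonWeight_nonneg l.coe_nonneg n), mul_comm]
  · intro n
    exact ENNReal.mul_ne_top ((h1 n).trans_lt ENNReal.one_lt_top).ne ENNReal.ofReal_ne_top

lemma lintegral_poissonMeasure_le_one (l : ℝ≥0) {h : ℕ → ℝ≥0∞} (h1 : ∀ n, h n ≤ 1) :
    ∫⁻ n, h n ∂(poissonMeasure l) ≤ 1 :=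
  (lintegral_mono h1).trans (by simp)

lemma coe_sqrt_nndist (a b : ℝ≥0) :
    ((nndist (NNReal.sqrt a) (NNReal.sqrt b) : ℝ≥0) : ℝ) = |√(a : ℝ) - √(b : ℝ)| := by
  rw [coe_nndist, NNReal.dist_eq, Real.coe_sqrt, Real.coe_sqrt]

lemma lintegral_poissonMeasure_le_add {h : ℕ → ℝ≥0∞} (h1 : ∀ n, h n ≤ 1) {v : ℝ≥0}
    (hd : ∀ l : ℝ, 0 < l → |∑' n, poissonWeight l n * (h (n + 1)).toReal
      - ∑' n, poissonWeight l n * (h n).toReal| ≤ v / √l) (l l' : ℝ≥0) :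
    ∫⁻ n, h n ∂(poissonMeasure l) ≤ ∫⁻ n, h n ∂(poissonMeasure l')
      + ((2 * v * nndist (NNReal.sqrt l) (NNReal.sqrt l') : ℝ≥0) : ℝ≥0∞) := by
  have hr1 : ∀ n, (h n).toReal ≤ 1 := fun n => by
    simpa using ENNReal.toReal_mono ENNReal.one_ne_top (h1 n)
  have hF := hasDerivAt_tsum_poissonWeight (h := fun n => (h n).toReal)
    (fun n => ENNReal.toReal_nonneg) hr1
  have key : ∀ a b : ℝ≥0, a ≤ b → |∑' n, poissonWeight b n * (h n).toReal
      - ∑' n, poissonWeight a n * (h n).toReal| ≤ 2 * v * |√(a : ℝ) - √(b : ℝ)| := by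
    intro a b hab
    rw [abs_sub_comm √(a : ℝ),
      abs_of_nonneg (sub_nonneg.2 (Real.sqrt_le_sqrt (NNReal.coe_le_coe.2 hab)))]
    exact sub_le_of_abs_deriv_le_div_sqrt hF hd a.coe_nonneg (NNReal.coe_le_coe.2 hab)
  have key' : ∑' n, poissonWeight l n * (h n).toReal
      ≤ ∑' n, poissonWeight l' n * (h n).toReal + 2 * v * |√(l : ℝ) - √(l' : ℝ)| := by
    rcases le_total l l' with hll | hll
    · have := key _ _ hll
      linarith [neg_abs_le (∑' n, poissonWeight l' n * (h n).toReal
      - ∑' n, poissonWeight l n * (h n).toReal)]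
    · have := key _ _ hll
      rw [abs_sub_comm √(l' : ℝ)] at this
      linarith [le_abs_self (∑' n, poissonWeight l n * (h n).toReal
      - ∑' n, poissonWeight l' n * (h n).toReal)]
  have hfin : ∀ l, ∫⁻ n, h n ∂(poissonMeasure l) ≠ ∞ := fun l =>
    ((lintegral_poissonMeasure_le_one l h1).trans_lt ENNReal.one_lt_top).ne
  rw [← ENNReal.toReal_le_toReal (hfin l) (ENNReal.add_ne_top.2 ⟨hfin l', ENNReal.coe_ne_top⟩),
    ENNReal.toReal_add (hfin l') ENNReal.coe_ne_top, toReal_lintegral_poissonMeasure l h1,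
    toReal_lintegral_poissonMeasure l' h1, ENNReal.coe_toReal]
  push_cast
  rw [← coe_nndist, coe_sqrt_nndist]
  exact key'

lemma lintegral_poissonMeasure_le_add_nndist {h : ℕ → ℝ≥0∞} (h1 : ∀ n, h n ≤ 1) (l l' : ℝ≥0) :
    ∫⁻ n, h n ∂(poissonMeasure l) ≤ ∫⁻ n, h n ∂(poissonMeasure l')
      + ((2 * nndist (NNReal.sqrt l) (NNReal.sqrt l') : ℝ≥0) : ℝ≥0∞) := by
  have hr1 : ∀ n, (h n).toReal ≤ 1 := fun n => by
    simpa using ENNReal.toReal_mono ENNReal.one_ne_top (h1 n)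
  have := lintegral_poissonMeasure_le_add h1 (v := 1) (fun x hx => by
    simpa using abs_poisson_difference_le (h := fun n => (h n).toReal)
      (fun n => ENNReal.toReal_nonneg) hr1 hx) l l'
  simpa using this

lemma lintegral_poissonMeasure_le_add_of_lipschitz {h : ℕ → ℝ≥0∞} (h1 : ∀ n, h n ≤ 1) {v : ℝ≥0}
    (hlip : ∀ n m : ℕ, h n ≤ h m + ((v * nndist (NNReal.sqrt n) (NNReal.sqrt m) : ℝ≥0) : ℝ≥0∞))
    (l l' : ℝ≥0) :
    ∫⁻ n, h n ∂(poissonMeasure l) ≤ ∫⁻ n, h n ∂(poissonMeasure l')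
      + ((2 * v * nndist (NNReal.sqrt l) (NNReal.sqrt l') : ℝ≥0) : ℝ≥0∞) := by
  have hr1 : ∀ n, (h n).toReal ≤ 1 := fun n => by
    simpa using ENNReal.toReal_mono ENNReal.one_ne_top (h1 n)
  have hfin : ∀ n, h n ≠ ∞ := fun n => ((h1 n).trans_lt ENNReal.one_lt_top).ne
  have hr : ∀ n m : ℕ, (h n).toReal ≤ (h m).toReal + v * |√(n : ℝ) - √(m : ℝ)| := by
    intro n m
    have := ENNReal.toReal_mono (ENNReal.add_ne_top.2 ⟨hfin m, ENNReal.coe_ne_top⟩) (hlip n m)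
    rw [ENNReal.toReal_add (hfin m) ENNReal.coe_ne_top, ENNReal.coe_toReal, NNReal.coe_mul,
      coe_sqrt_nndist] at this
    simpa using this
  refine lintegral_poissonMeasure_le_add h1 (fun x hx =>
    abs_poisson_difference_le_of_lipschitz (h := fun n => (h n).toReal)
      (fun n => ENNReal.toReal_nonneg) hr1 v.coe_nonneg (fun n => ?_) hx) l l'
  have hmono : √(n : ℝ) ≤ √((n + 1 : ℕ) : ℝ) := Real.sqrt_le_sqrt (by push_cast; linarith)
  have a1 := hr (n + 1) n
  have a2 := hr n (n + 1)
  rw [abs_of_nonneg (sub_nonneg.2 hmono)] at a1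
  rw [abs_sub_comm, abs_of_nonneg (sub_nonneg.2 hmono)] at a2
  rw [abs_le]
  constructor <;> linarith

lemma lintegral_poissonMeasure_nndist_sqrt_le_one (l : ℝ≥0) :
    ∫⁻ n : ℕ, (nndist (NNReal.sqrt n) (NNReal.sqrt l) : ℝ≥0∞) ∂(poissonMeasure l) ≤ 1 := by
  rw [lintegral_poissonMeasure]
  have hcoe : ∀ n : ℕ, (nndist (NNReal.sqrt n) (NNReal.sqrt l) : ℝ≥0∞)
      = ENNReal.ofReal |√(n : ℝ) - √(l : ℝ)| := fun n => by
    rw [← ENNReal.ofReal_coe_nnreal, coe_sqrt_nndist]; simp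
  simp_rw [hcoe]
  rcases eq_or_lt_of_le (zero_le (a := l)) with rfl | hl
  · refine le_of_eq_of_le (ENNReal.tsum_eq_zero.2 fun n => ?_) zero_le_one
    rcases n with _ | n
    · simp
    · simp [poissonWeight]
  · have hl' : (0 : ℝ) < l := hl
    have hs := Real.sqrt_pos.2 hl'
    have hss : √(l : ℝ) * √(l : ℝ) = l := Real.mul_self_sqrt hl'.le
    have hb := hasSum_poissonWeight_deviation hl'
    have : (1 : ℝ≥0∞) = ∑' n : ℕ, ENNReal.ofReal
        (poissonWeight l n * (1 / 2 * (1 + ((n : ℝ) - l) ^ 2 / l))) := by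
      rw [← ENNReal.ofReal_tsum_of_nonneg (fun n =>
        mul_nonneg (poissonWeight_nonneg l.coe_nonneg n) (by positivity)) hb.summable, hb.tsum_eq]
      simp
    rw [this]
    refine ENNReal.tsum_le_tsum fun n => ?_
    rw [← ENNReal.ofReal_mul (abs_nonneg _), mul_comm]
    refine ENNReal.ofReal_le_ofReal (mul_le_mul_of_nonneg_left ?_ (poissonWeight_nonneg l.coe_nonneg n))
    have h1 := abs_sub_div_le hl' n
    -- Factor n - l as a difference of squares and drop √n; `abs_sub_div_le` then yields a majorant
    -- of mean 1.
    have h2 : |√(n : ℝ) - √(l : ℝ)| * √(l : ℝ) ≤ |(n : ℝ) - l| := by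
      have e : (n : ℝ) - l = (√(n : ℝ) - √(l : ℝ)) * (√(n : ℝ) + √(l : ℝ)) := by
        nlinarith [Real.mul_self_sqrt (Nat.cast_nonneg (α := ℝ) n)]
      rw [e, abs_mul, abs_of_nonneg (by positivity : 0 ≤ √(n : ℝ) + √(l : ℝ))]
      gcongr
      linarith [Real.sqrt_nonneg (n : ℝ)]
    have h3 : |√(n : ℝ) - √(l : ℝ)| / √(l : ℝ) ≤ |(n : ℝ) - l| / l := by
      rw [div_le_div_iff₀ hs hl']
      nlinarith [abs_nonneg (√(n : ℝ) - √(l : ℝ))]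
    have h4 := h3.trans h1
    rw [one_div_mul_eq_div, div_le_div_iff_of_pos_right hs] at h4
    exact h4

end

noncomputable section

/-! ### The square-root distance -/

/-- The distance of the square roots of two non-negative numbers. -/
def sqrtDist (a b : ℝ≥0) : ℝ≥0 := nndist (NNReal.sqrt a) (NNReal.sqrt b)

lemma coe_sqrtDist (a b : ℝ≥0) : (sqrtDist a b : ℝ) = |√(a : ℝ) - √(b : ℝ)| :=
  coe_sqrt_nndist a b

@[simp] lemma sqrtDist_self (a : ℝ≥0) : sqrtDist a a = 0 := nndist_self _

lemma sqrtDist_comm (a b : ℝ≥0) : sqrtDist a b = sqrtDist b a := nndist_comm _ _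

lemma sqrtDist_triangle (a b c : ℝ≥0) : sqrtDist a c ≤ sqrtDist a b + sqrtDist b c :=
  nndist_triangle _ _ _

@[fun_prop] lemma Measurable.sqrtDist {α : Type*} {_ : MeasurableSpace α} {f g : α → ℝ≥0}
    (hf : Measurable f) (hg : Measurable g) : Measurable fun x => sqrtDist (f x) (g x) := by
  unfold _root_.sqrtDist
  exact (NNReal.continuous_sqrt.measurable.comp hf).nndist
    (NNReal.continuous_sqrt.measurable.comp hg)

lemma sqrtDist_mul (c a b : ℝ≥0) : sqrtDist (c * a) (c * b) = NNReal.sqrt c * sqrtDist a b := by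
  apply NNReal.coe_injective
  rw [NNReal.coe_mul, coe_sqrtDist, coe_sqrtDist, NNReal.coe_mul, NNReal.coe_mul,
    Real.sqrt_mul c.coe_nonneg, Real.sqrt_mul c.coe_nonneg, ← mul_sub, abs_mul,
    abs_of_nonneg (Real.sqrt_nonneg _), Real.coe_sqrt]

/-- √(a + b) is the Euclidean norm of (√a, √b), hence 1-Lipschitz in these coordinates, also for the
larger ℓ¹ norm. -/
lemma sqrt_add_le_sqrt_add_add {a b a' b' : ℝ} (ha : 0 ≤ a) (hb : 0 ≤ b) (ha' : 0 ≤ a')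
    (hb' : 0 ≤ b') : √(a + b) ≤ √(a' + b') + (|√a - √a'| + |√b - √b'|) := by
  have hs : 0 ≤ √(a' + b') := Real.sqrt_nonneg _
  rw [Real.sqrt_le_left (by positivity)]
  have e1 : √a ≤ √a' + |√a - √a'| := by linarith [le_abs_self (√a - √a')]
  have e2 : √b ≤ √b' + |√b - √b'| := by linarith [le_abs_self (√b - √b')]
  have l1 : √a' ≤ √(a' + b') := Real.sqrt_le_sqrt (by linarith)
  have l2 : √b' ≤ √(a' + b') := Real.sqrt_le_sqrt (by linarith)
  have f1 : a ≤ (√a' + |√a - √a'|) ^ 2 := by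
    rw [← Real.sq_sqrt ha]; simpa using pow_le_pow_left₀ (Real.sqrt_nonneg a) e1 2
  have f2 : b ≤ (√b' + |√b - √b'|) ^ 2 := by
    rw [← Real.sq_sqrt hb]; simpa using pow_le_pow_left₀ (Real.sqrt_nonneg b) e2 2
  have g1 := Real.sq_sqrt ha'
  have g2 := Real.sq_sqrt hb'
  have g3 := Real.sq_sqrt (add_nonneg ha' hb')
  set p := |√a - √a'|
  set q := |√b - √b'|
  have hp : 0 ≤ p := abs_nonneg _
  have hq : 0 ≤ q := abs_nonneg _
  nlinarith [mul_le_mul_of_nonneg_left l1 hp, mul_le_mul_of_nonneg_left l2 hq, mul_nonneg hp hq]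

lemma sqrtDist_add_le (a b a' b' : ℝ≥0) :
    sqrtDist (a + b) (a' + b') ≤ sqrtDist a a' + sqrtDist b b' := by
  rw [← NNReal.coe_le_coe, NNReal.coe_add, coe_sqrtDist, coe_sqrtDist, coe_sqrtDist,
    NNReal.coe_add, NNReal.coe_add, abs_sub_le_iff]
  have h1 := sqrt_add_le_sqrt_add_add a.coe_nonneg b.coe_nonneg a'.coe_nonneg b'.coe_nonneg
  have h2 := sqrt_add_le_sqrt_add_add a'.coe_nonneg b'.coe_nonneg a.coe_nonneg b.coe_nonneg
  rw [abs_sub_comm √(a' : ℝ), abs_sub_comm √(b' : ℝ)] at h2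
  constructor <;> linarith

lemma sqrtDist_sum_le {ι : Type*} (s : Finset ι) (f g : ι → ℝ≥0) :
    sqrtDist (∑ i ∈ s, f i) (∑ i ∈ s, g i) ≤ ∑ i ∈ s, sqrtDist (f i) (g i) := by
  classical
  induction s using Finset.induction_on with
  | empty => simp
  | insert i s hi ih =>
    rw [Finset.sum_insert hi, Finset.sum_insert hi, Finset.sum_insert hi]
    exact (sqrtDist_add_le _ _ _ _).trans (by gcongr)

variable {d : ℕ}

/-- The vector of coordinatewise square-root distances. -/
def sqrtDistVec (l l' : Fin d → ℝ≥0) : Fin d → ℝ≥0 := fun j => sqrtDist (l j) (l' j)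

lemma sqrtDistVec_mulVec_le (A : Matrix (Fin d) (Fin d) ℝ≥0) (l l' : Fin d → ℝ≥0) :
    sqrtDistVec (A *ᵥ l) (A *ᵥ l') ≤ A.map NNReal.sqrt *ᵥ sqrtDistVec l l' := by
  intro i
  simp only [sqrtDistVec, Matrix.mulVec, dotProduct, Matrix.map_apply, ← sqrtDist_mul]
  exact sqrtDist_sum_le _ _ _

lemma sqrtDistVec_add_le (l l' k k' : Fin d → ℝ≥0) :
    sqrtDistVec (l + k) (l' + k') ≤ sqrtDistVec l l' + sqrtDistVec k k' :=
  fun _ => sqrtDist_add_le _ _ _ _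

@[simp] lemma sqrtDistVec_self (l : Fin d → ℝ≥0) : sqrtDistVec l l = 0 := by
  ext; simp [sqrtDistVec]

/-- The intensity recursion is Lipschitz in the square-root distance. -/
lemma sqrtDistVec_recursion_le (A B : Matrix (Fin d) (Fin d) ℝ≥0)
    (l l' x x' z z' : Fin d → ℝ≥0) :
    sqrtDistVec (A *ᵥ l + B *ᵥ x + z) (A *ᵥ l' + B *ᵥ x' + z') ≤
      A.map NNReal.sqrt *ᵥ sqrtDistVec l l' + B.map NNReal.sqrt *ᵥ sqrtDistVec x x'
        + sqrtDistVec z z' := by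
  intro i
  have h1 := sqrtDistVec_add_le (A *ᵥ l + B *ᵥ x) (A *ᵥ l' + B *ᵥ x') z z' i
  have h2 := sqrtDistVec_add_le (A *ᵥ l) (A *ᵥ l') (B *ᵥ x) (B *ᵥ x') i
  have h3 := sqrtDistVec_mulVec_le A l l' i
  have h4 := sqrtDistVec_mulVec_le B x x' i
  simp only [Pi.add_apply] at h1 h2 ⊢
  exact h1.trans (add_le_add (h2.trans (add_le_add h3 h4)) le_rfl)

/-! ### Multivariate Poisson laws -/

instance (l : Fin d → ℝ≥0) : IsProbabilityMeasure (poissonVec l) := by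
  unfold poissonVec; infer_instance

lemma map_update_poissonVec_prod (l : Fin d → ℝ≥0) (i : Fin d) (s : ℝ≥0) :
    ((poissonVec l).prod (poissonMeasure s)).map (fun p => Function.update p.1 i p.2)
      = poissonVec (Function.update l i s) := by
  unfold poissonVec
  refine (Measure.pi_eq fun S hS => ?_).symm
  rw [Measure.map_apply Measurable.of_discrete (MeasurableSet.univ_pi hS)]
  have : (fun p : (Fin d → ℕ) × ℕ => Function.update p.1 i p.2) ⁻¹' (Set.univ.pi S)
      = (Set.univ.pi (Function.update S i Set.univ)) ×ˢ (S i) := by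
    ext ⟨x, n⟩
    simp only [Set.mem_preimage, Set.mem_univ_pi, Set.mem_prod]
    constructor
    · intro h
      refine ⟨fun j => ?_, by simpa using h i⟩
      by_cases hj : j = i
      · subst hj; simp
      · simpa [hj] using h j
    · rintro ⟨h1, h2⟩ j
      by_cases hj : j = i
      · subst hj; simpa using h2
      · simpa [hj] using h1 j
  rw [this, Measure.prod_prod, Measure.pi_pi, ← Finset.mul_prod_erase _ _ (Finset.mem_univ i),
    ← Finset.mul_prod_erase _ _ (Finset.mem_univ i)]
  simp only [Function.update_self, measure_univ, one_mul]
  rw [mul_comm]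
  congr 1
  refine Finset.prod_congr rfl fun j hj => ?_
  rw [Function.update_of_ne (Finset.ne_of_mem_erase hj),
    Function.update_of_ne (Finset.ne_of_mem_erase hj)]

lemma lintegral_poissonVec_update (l : Fin d → ℝ≥0) (i : Fin d) (s : ℝ≥0)
    (h : (Fin d → ℕ) → ℝ≥0∞) :
    ∫⁻ x, h x ∂(poissonVec (Function.update l i s))
      = ∫⁻ x, ∫⁻ n, h (Function.update x i n) ∂(poissonMeasure s) ∂(poissonVec l) := by
  rw [← map_update_poissonVec_prod,
    lintegral_map Measurable.of_discrete Measurable.of_discrete,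
    lintegral_prod _ Measurable.of_discrete.aemeasurable]

/-- Telescoping over coordinates exchanged one at a time; it reduces the multivariate Poisson bounds
to dimension one. -/
lemma le_add_sum_of_forall_update {α : Type*} {H : (Fin d → α) → ℝ≥0∞} {D : Fin d → α → α → ℝ≥0∞}
    (hH : ∀ l i s, H l ≤ H (Function.update l i s) + D i (l i) s) (l l' : Fin d → α) :
    H l ≤ H l' + ∑ i, D i (l i) (l' i) := by
  have key : ∀ s : Finset (Fin d), H l ≤ H (s.piecewise l' l) + ∑ i ∈ s, D i (l i) (l' i) := by
    intro s
    induction s using Finset.induction_on with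
    | empty => simp
    | insert j s hj ih =>
      refine ih.trans ?_
      rw [Finset.piecewise_insert, Finset.sum_insert hj, ← add_assoc]
      gcongr
      have := hH (s.piecewise l' l) j (l' j)
      rwa [Finset.piecewise_eq_of_notMem _ _ _ hj] at this
  simpa using key Finset.univ

lemma lintegral_poissonVec_le_add_sum {h : (Fin d → ℕ) → ℝ≥0∞} {c : Fin d → ℝ≥0}
    (hc : ∀ x i (l l' : ℝ≥0), ∫⁻ n, h (Function.update x i n) ∂(poissonMeasure l)
      ≤ ∫⁻ n, h (Function.update x i n) ∂(poissonMeasure l') + ((c i * sqrtDist l l' : ℝ≥0) : ℝ≥0∞))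
    (l l' : Fin d → ℝ≥0) :
    ∫⁻ x, h x ∂(poissonVec l) ≤ ∫⁻ x, h x ∂(poissonVec l')
      + ((c ⬝ᵥ sqrtDistVec l l' : ℝ≥0) : ℝ≥0∞) := by
  have := le_add_sum_of_forall_update (H := fun l => ∫⁻ x, h x ∂(poissonVec l))
    (D := fun i a b => ((c i * sqrtDist a b : ℝ≥0) : ℝ≥0∞)) (fun l i s => ?_) l l'
  · refine this.trans (le_of_eq ?_)
    simp only [dotProduct, sqrtDistVec]
    push_cast
    rfl
  · rw [lintegral_poissonVec_update]
    conv_lhs => rw [← Function.update_eq_self i l, lintegral_poissonVec_update]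
    refine (lintegral_mono fun x => hc x i (l i) s).trans (le_of_eq ?_)
    rw [lintegral_add_right _ measurable_const]
    simp

/-- Total variation bound for multivariate Poisson laws. -/
lemma lintegral_poissonVec_le_add {h : (Fin d → ℕ) → ℝ≥0∞} (h1 : ∀ x, h x ≤ 1)
    (l l' : Fin d → ℝ≥0) :
    ∫⁻ x, h x ∂(poissonVec l) ≤ ∫⁻ x, h x ∂(poissonVec l')
      + (((fun _ => 2) ⬝ᵥ sqrtDistVec l l' : ℝ≥0) : ℝ≥0∞) :=
  lintegral_poissonVec_le_add_sum (fun _ _ l l' =>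
    lintegral_poissonMeasure_le_add_nndist (fun _ => h1 _) l l') l l'

/-- Transport bound for multivariate Poisson laws in the square-root distance. -/
lemma lintegral_poissonVec_le_add_of_lipschitz {h : (Fin d → ℕ) → ℝ≥0∞} (h1 : ∀ x, h x ≤ 1)
    {v : Fin d → ℝ≥0}
    (hlip : ∀ x y : Fin d → ℕ, h x ≤ h y
      + ((v ⬝ᵥ sqrtDistVec (fun j => (x j : ℝ≥0)) (fun j => (y j : ℝ≥0)) : ℝ≥0) : ℝ≥0∞))
    (l l' : Fin d → ℝ≥0) :
    ∫⁻ x, h x ∂(poissonVec l) ≤ ∫⁻ x, h x ∂(poissonVec l')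
      + (((2 • v) ⬝ᵥ sqrtDistVec l l' : ℝ≥0) : ℝ≥0∞) := by
  refine lintegral_poissonVec_le_add_sum (fun x i l l' => ?_) l l'
  have := lintegral_poissonMeasure_le_add_of_lipschitz (h := fun n => h (Function.update x i n))
    (fun _ => h1 _) (v := v i) (fun n m => ?_) l l'
  · simpa [sqrtDist] using this
  · refine (hlip _ (Function.update x i m)).trans (le_of_eq ?_)
    congr 2
    simp only [dotProduct, sqrtDistVec]
    rw [Finset.sum_eq_single i]
    · simp [sqrtDist]
    · intro j _ hj; simp [hj]
    · simp

lemma lintegral_poissonVec_eval (l : Fin d → ℝ≥0) (i : Fin d) (h : ℕ → ℝ≥0∞) :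
    ∫⁻ x, h (x i) ∂(poissonVec l) = ∫⁻ n, h n ∂(poissonMeasure (l i)) := by
  unfold poissonVec
  rw [← lintegral_map (f := h) Measurable.of_discrete (measurable_pi_apply i),
    (measurePreserving_eval _ i).map_eq]

lemma lintegral_poissonVec_sqrtDist_le_one (l : Fin d → ℝ≥0) (i : Fin d) :
    ∫⁻ x, (sqrtDist (x i) (l i) : ℝ≥0∞) ∂(poissonVec l) ≤ 1 := by
  rw [lintegral_poissonVec_eval l i fun n => (sqrtDist n (l i) : ℝ≥0∞)]
  exact lintegral_poissonMeasure_nndist_sqrt_le_one (l i)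

lemma measurable_poissonVec_singleton (x : Fin d → ℕ) :
    Measurable fun l : Fin d → ℝ≥0 => poissonVec l {x} := by
  have : (fun l : Fin d → ℝ≥0 => poissonVec l {x})
      = fun l => ∏ i, ENNReal.ofReal (Real.exp (-(l i : ℝ)) * (l i : ℝ) ^ x i / (x i).factorial) := by
    ext l
    unfold poissonVec
    rw [Measure.pi_singleton]
    simp_rw [poissonMeasure_singleton]
  rw [this]
  fun_prop

lemma measurable_lintegral_poissonVec {α : Type*} [MeasurableSpace α]
    {h : α → (Fin d → ℕ) → ℝ≥0∞} (hh : ∀ x, Measurable fun a => h a x) {l : α → Fin d → ℝ≥0}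
    (hl : Measurable l) : Measurable fun a => ∫⁻ x, h a x ∂(poissonVec (l a)) := by
  simp_rw [lintegral_countable']
  exact Measurable.tsum fun x => (hh x).mul ((measurable_poissonVec_singleton x).comp hl)

end

noncomputable section

/-! ### Backward evaluation of path functionals -/

variable {d : ℕ}

/-- The expectation of the path functional `g`, given that the chain is at time `t` with intensity
`l`, that the counts at other times are `ξ`, and that counts at times `t, …, t + n - 1` are drawn
from the model whose covariates have laws `ν`. -/
def condValue (A B : Matrix (Fin d) (Fin d) ℝ≥0) (ν : ℕ → Measure (Fin d → ℝ≥0))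
    (g : (ℕ → Fin d → ℕ) → ℝ≥0∞) : ℕ → ℕ → (ℕ → Fin d → ℕ) → (Fin d → ℝ≥0) → ℝ≥0∞
  | 0, _, ξ, _ => g ξ
  | n + 1, t, ξ, l => ∫⁻ x, ∫⁻ z, condValue A B ν g n (t + 1) (Function.update ξ t x)
      (A *ᵥ l + B *ᵥ (fun j => (x j : ℝ≥0)) + z) ∂(ν t) ∂(poissonVec l)

/-- The matrix `√A + 2√B` with entries in `ℝ≥0`. -/
def sqrtMatrixNN (A B : Matrix (Fin d) (Fin d) ℝ≥0) : Matrix (Fin d) (Fin d) ℝ≥0 :=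
  A.map NNReal.sqrt + 2 • B.map NNReal.sqrt

/-- The weights `∑_{i < n} 2 · 1ᵀ M^{i+j}`. -/
def lipWeight (M : Matrix (Fin d) (Fin d) ℝ≥0) (n j : ℕ) : Fin d → ℝ≥0 :=
  ∑ i ∈ Finset.range n, (fun _ => 2) ᵥ* M ^ (i + j)

lemma lipWeight_succ_right (M : Matrix (Fin d) (Fin d) ℝ≥0) (n j : ℕ) :
    lipWeight M n (j + 1) = lipWeight M n j ᵥ* M := by
  simp only [lipWeight, Matrix.sum_vecMul, Matrix.vecMul_vecMul, ← pow_succ, add_assoc]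

lemma lipWeight_succ_left (M : Matrix (Fin d) (Fin d) ℝ≥0) (n : ℕ) :
    lipWeight M (n + 1) 0 = (fun _ => 2) + lipWeight M n 0 ᵥ* M := by
  rw [← lipWeight_succ_right, lipWeight, Finset.sum_range_succ', add_comm]
  simp [lipWeight, add_comm]

lemma dotProduct_mono_right {v w w' : Fin d → ℝ≥0} (h : w ≤ w') : v ⬝ᵥ w ≤ v ⬝ᵥ w' :=
  Finset.sum_le_sum fun i _ => mul_le_mul_right (h i) (v i)

lemma dotProduct_sqrtDistVec_recursion_le (A B : Matrix (Fin d) (Fin d) ℝ≥0)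
    (w l l' x x' z : Fin d → ℝ≥0) :
    w ⬝ᵥ sqrtDistVec (A *ᵥ l + B *ᵥ x + z) (A *ᵥ l' + B *ᵥ x' + z) ≤
      (w ᵥ* A.map NNReal.sqrt) ⬝ᵥ sqrtDistVec l l'
        + (w ᵥ* B.map NNReal.sqrt) ⬝ᵥ sqrtDistVec x x' := by
  refine (dotProduct_mono_right (sqrtDistVec_recursion_le A B l l' x x' z z)).trans ?_
  rw [sqrtDistVec_self, add_zero, dotProduct_add, Matrix.dotProduct_mulVec,
    Matrix.dotProduct_mulVec]

variable {A B : Matrix (Fin d) (Fin d) ℝ≥0} {ν : ℕ → Measure (Fin d → ℝ≥0)}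
  {g : (ℕ → Fin d → ℕ) → ℝ≥0∞}

lemma measurable_mulVec (A : Matrix (Fin d) (Fin d) ℝ≥0) :
    Measurable fun l : Fin d → ℝ≥0 => A *ᵥ l := by
  refine measurable_pi_iff.2 fun i => ?_
  simp only [Matrix.mulVec, dotProduct]
  fun_prop

lemma measurable_update_path (t : ℕ) (x : Fin d → ℕ) :
    Measurable fun ξ : ℕ → Fin d → ℕ => Function.update ξ t x := by
  refine measurable_pi_iff.2 fun s => ?_
  by_cases h : s = t
  · subst h; simp
  · simpa [h] using measurable_pi_apply s

lemma measurable_condValue [∀ t, IsProbabilityMeasure (ν t)] (hg : Measurable g) (n : ℕ) :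
    ∀ t, Measurable fun p : (ℕ → Fin d → ℕ) × (Fin d → ℝ≥0) => condValue A B ν g n t p.1 p.2 := by
  induction n with
  | zero => intro t; exact hg.comp measurable_fst
  | succ n ih =>
    intro t
    refine measurable_lintegral_poissonVec (fun x => ?_) measurable_snd
    refine Measurable.lintegral_prod_right' (f := fun q : ((ℕ → Fin d → ℕ) × (Fin d → ℝ≥0)) ×
      (Fin d → ℝ≥0) => condValue A B ν g n (t + 1) (Function.update q.1.1 t x)
      (A *ᵥ q.1.2 + B *ᵥ (fun j => (x j : ℝ≥0)) + q.2)) ?_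
    have h1 : Measurable fun q : ((ℕ → Fin d → ℕ) × (Fin d → ℝ≥0)) × (Fin d → ℝ≥0) =>
        Function.update q.1.1 t x :=
      (measurable_update_path t x).comp (measurable_fst.comp measurable_fst)
    have h2 : Measurable fun q : ((ℕ → Fin d → ℕ) × (Fin d → ℝ≥0)) × (Fin d → ℝ≥0) =>
        A *ᵥ q.1.2 := (measurable_mulVec A).comp (measurable_snd.comp measurable_fst)
    exact (ih (t + 1)).comp (h1.prodMk ((h2.add_const _).add measurable_snd))

lemma condValue_le_one [∀ t, IsProbabilityMeasure (ν t)] (hg : ∀ ξ, g ξ ≤ 1) (n : ℕ) :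
    ∀ t ξ l, condValue A B ν g n t ξ l ≤ 1 := by
  induction n with
  | zero => intro t ξ l; exact hg ξ
  | succ n ih =>
    intro t ξ l
    refine (lintegral_mono fun x => (lintegral_mono fun z => ih _ _ _).trans ?_).trans
      (b := ∫⁻ _, 1 ∂(poissonVec l)) ?_
    · simp
    · simp

/-- Consequently counts drawn before time `m` affect the value only through the intensity. -/
lemma condValue_congr (m : ℕ) (hg : ∀ ξ ξ', (∀ s ≥ m, ξ s = ξ' s) → g ξ = g ξ') (n : ℕ) :
    ∀ t ξ ξ' l, (∀ s ≥ m, ξ s = ξ' s) → condValue A B ν g n t ξ l = condValue A B ν g n t ξ' l := by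
  induction n with
  | zero => intro t ξ ξ' l h; exact hg _ _ h
  | succ n ih =>
    intro t ξ ξ' l h
    simp only [condValue]
    refine lintegral_congr fun x => lintegral_congr fun z => ih _ _ _ _ fun s hs => ?_
    by_cases hst : s = t
    · subst hst; simp
    · simp [hst, h s hs]

/-- Both sides use the same covariate `z`, which cancels in the distance; no moment of `ν t` enters.
-/
lemma lintegral_condValue_le [∀ t, IsProbabilityMeasure (ν t)] {n t : ℕ} {w : Fin d → ℝ≥0}
    {ξ ξ' : ℕ → Fin d → ℕ}
    (h : ∀ l l', condValue A B ν g n (t + 1) ξ l ≤ condValue A B ν g n (t + 1) ξ' l'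
      + ((w ⬝ᵥ sqrtDistVec l l' : ℝ≥0) : ℝ≥0∞)) (l l' x x' : Fin d → ℝ≥0) :
    ∫⁻ z, condValue A B ν g n (t + 1) ξ (A *ᵥ l + B *ᵥ x + z) ∂(ν t)
      ≤ ∫⁻ z, condValue A B ν g n (t + 1) ξ' (A *ᵥ l' + B *ᵥ x' + z) ∂(ν t)
      + (((w ᵥ* A.map NNReal.sqrt) ⬝ᵥ sqrtDistVec l l'
        + (w ᵥ* B.map NNReal.sqrt) ⬝ᵥ sqrtDistVec x x' : ℝ≥0) : ℝ≥0∞) := by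
  refine (lintegral_mono fun z => (h _ (A *ᵥ l' + B *ᵥ x' + z)).trans
    (add_le_add_right (ENNReal.coe_le_coe.2
      (dotProduct_sqrtDistVec_recursion_le A B w l l' x x' z)) _)).trans (le_of_eq ?_)
  rw [lintegral_add_right _ measurable_const]
  simp

/-- The value function is Lipschitz in the square-root distance of the intensity. -/
lemma condValue_le_add [∀ t, IsProbabilityMeasure (ν t)] (hg : ∀ ξ, g ξ ≤ 1) (n : ℕ) :
    ∀ t ξ l l', condValue A B ν g n t ξ l ≤ condValue A B ν g n t ξ l'
      + ((lipWeight (sqrtMatrixNN A B) n 0 ⬝ᵥ sqrtDistVec l l' : ℝ≥0) : ℝ≥0∞) := by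
  induction n with
  | zero => intro t ξ l l'; exact le_self_add
  | succ n ih =>
    intro t ξ l l'
    set w := lipWeight (sqrtMatrixNN A B) n 0
    have h1 : ∀ x : Fin d → ℕ, ∫⁻ z, condValue A B ν g n (t + 1) (Function.update ξ t x)
        (A *ᵥ l + B *ᵥ (fun j => (x j : ℝ≥0)) + z) ∂(ν t) ≤ 1 := fun x =>
      (lintegral_mono fun z => condValue_le_one hg _ _ _ _).trans (by simp)
    -- The law of the count is changed at total variation price 2 per unit distance; afterwards both
    -- sides share the same `x`.
    refine (lintegral_poissonVec_le_add h1 l l').trans ?_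
    refine (add_le_add_left (lintegral_mono fun x => lintegral_condValue_le
      (fun l l' => ih (t + 1) (Function.update ξ t x) l l') l l' _ (fun j => (x j : ℝ≥0))) _).trans ?_
    simp only [sqrtDistVec_self, dotProduct_zero, add_zero]
    rw [lintegral_add_right _ measurable_const, lintegral_const, measure_univ, mul_one, add_assoc,
      ← ENNReal.coe_add]
    refine add_le_add_right (ENNReal.coe_le_coe.2 ?_) _
    -- Shared counts leave only the weight `w √A`; it is enlarged to `w (√A + 2√B)` to keep a single
    -- matrix.
    rw [lipWeight_succ_left, add_dotProduct, sqrtMatrixNN, Matrix.vecMul_add, add_dotProduct,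
      add_comm]
    gcongr
    exact le_self_add

/-- The value of a functional of the counts from time `m` on contracts geometrically in the time
left until `m`. -/
lemma condValue_le_add_contraction [∀ t, IsProbabilityMeasure (ν t)] (hg : ∀ ξ, g ξ ≤ 1) (m : ℕ)
    (hgm : ∀ ξ ξ', (∀ s ≥ m, ξ s = ξ' s) → g ξ = g ξ') (n j : ℕ) :
    ∀ t, t + j = m → ∀ ξ l l', condValue A B ν g (n + j) t ξ l ≤ condValue A B ν g (n + j) t ξ l'
      + ((lipWeight (sqrtMatrixNN A B) n j ⬝ᵥ sqrtDistVec l l' : ℝ≥0) : ℝ≥0∞) := by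
  induction j with
  | zero => intro t _ ξ l l'; exact condValue_le_add hg n t ξ l l'
  | succ j ih =>
    intro t ht ξ l l'
    set w := lipWeight (sqrtMatrixNN A B) n j with hw
    have ih' := ih (t + 1) (by omega)
    have h1 : ∀ x : Fin d → ℕ, ∫⁻ z, condValue A B ν g (n + j) (t + 1) (Function.update ξ t x)
        (A *ᵥ l + B *ᵥ (fun j => (x j : ℝ≥0)) + z) ∂(ν t) ≤ 1 := fun x =>
      (lintegral_mono fun z => condValue_le_one hg _ _ _ _).trans (by simp)
    have h2 : ∀ (x y : Fin d → ℕ) l l',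
        condValue A B ν g (n + j) (t + 1) (Function.update ξ t x) l
          ≤ condValue A B ν g (n + j) (t + 1) (Function.update ξ t y) l'
            + ((w ⬝ᵥ sqrtDistVec l l' : ℝ≥0) : ℝ≥0∞) := by
      intro x y l l'
      -- Here `t < m`, so the count at time `t` is not observed.
      rw [condValue_congr m hgm (n + j) (t + 1) (Function.update ξ t x) (Function.update ξ t y) l
        fun s hs => by
          have : s ≠ t := by omega
          simp [this]]
      exact ih' _ _ _
    -- With `l` frozen in the integrand, the dependence on `x` is Lipschitz with weight `w √B`.
    -- Changing the Poisson law costs twice that, and changing `l` inside costs `w √A`: in total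
    -- exactly `w M`.
    refine (lintegral_poissonVec_le_add_of_lipschitz h1 (v := w ᵥ* B.map NNReal.sqrt)
      (fun x y => ?_) l l').trans ?_
    · have := lintegral_condValue_le (A := A) (B := B) (h2 x y) l l (fun j => (x j : ℝ≥0))
        (fun j => (y j : ℝ≥0))
      simpa only [sqrtDistVec_self, dotProduct_zero, zero_add] using this
    refine (add_le_add_left (lintegral_mono fun x => lintegral_condValue_le
      (h2 x x) l l' _ (fun j => (x j : ℝ≥0))) _).trans ?_
    simp only [sqrtDistVec_self, dotProduct_zero, add_zero]
    rw [lintegral_add_right _ measurable_const, lintegral_const, measure_univ, mul_one, add_assoc,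
      ← ENNReal.coe_add]
    refine add_le_add_right (ENNReal.coe_le_coe.2 ?_) _
    rw [lipWeight_succ_right, ← hw, sqrtMatrixNN, Matrix.vecMul_add, add_dotProduct,
      Matrix.vecMul_smul]

end

noncomputable section

/-! ### Conditional evaluation of the model -/

/-- The measures μ restricted to `S` and μ with density `p` agree on `m`. The density itself need
not be `m`-measurable. -/
lemma setLIntegral_eq_lintegral_mul_of_sub_sigma {Ω : Type*} {m mΩ : MeasurableSpace Ω}
    {μ : Measure Ω} (hm : m ≤ mΩ) {S : Set Ω} {p : Ω → ℝ≥0∞} (hp : Measurable p)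
    (h : ∀ D, MeasurableSet[m] D → μ (D ∩ S) = ∫⁻ ω in D, p ω ∂μ) {f : Ω → ℝ≥0∞}
    (hf : Measurable[m] f) : ∫⁻ ω in S, f ω ∂μ = ∫⁻ ω, f ω * p ω ∂μ := by
  have key : (μ.restrict S).trim hm = (μ.withDensity p).trim hm := by
    refine @Measure.ext _ m _ _ fun D hD => ?_
    rw [trim_measurableSet_eq hm hD, trim_measurableSet_eq hm hD,
      Measure.restrict_apply (hm D hD), withDensity_apply _ (hm D hD), h D hD]
  rw [← lintegral_trim hm hf, key, lintegral_trim hm hf,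
    lintegral_withDensity_eq_lintegral_mul _ hp (hf.mono hm le_rfl)]
  simp only [Pi.mul_apply, mul_comm]

lemma measure_inter_eq_setLIntegral_of_condExp {Ω : Type*} {m mΩ : MeasurableSpace Ω}
    {μ : Measure Ω} [IsProbabilityMeasure μ] (hm : m ≤ mΩ) {S : Set Ω} (hS : MeasurableSet S)
    {p : Ω → ℝ≥0∞} (hp : Measurable p) (hp1 : ∀ ω, p ω ≤ 1)
    (h : μ[S.indicator (fun _ => (1 : ℝ)) | m] =ᵐ[μ] fun ω => (p ω).toReal)
    {D : Set Ω} (hD : MeasurableSet[m] D) : μ (D ∩ S) = ∫⁻ ω in D, p ω ∂μ := by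
  have h1 : ∫ ω in D, S.indicator (fun _ => (1 : ℝ)) ω ∂μ = ∫ ω in D, (p ω).toReal ∂μ := by
    rw [← setIntegral_condExp hm ((integrable_const (1 : ℝ)).indicator hS) hD]
    exact integral_congr_ae (ae_restrict_of_ae h)
  rw [integral_toReal hp.aemeasurable
    (ae_of_all _ fun ω => (hp1 ω).trans_lt ENNReal.one_lt_top), integral_indicator hS,
    setIntegral_const, smul_eq_mul, mul_one, Measure.real, Measure.restrict_apply hS] at h1
  have hfin : ∫⁻ ω in D, p ω ∂μ ≠ ∞ :=
    ((lintegral_mono hp1).trans_lt (by simp)).ne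
  rw [Set.inter_comm]
  exact (ENNReal.toReal_eq_toReal_iff' (measure_ne_top _ _) hfin).1 h1

lemma lintegral_comp_prodMk_of_indep {Ω S T : Type*} [MeasurableSpace S] [MeasurableSpace T]
    {m mΩ : MeasurableSpace Ω} {μ : Measure Ω} [IsProbabilityMeasure μ] (hm : m ≤ mΩ) {Z : Ω → T}
    (hZ : Measurable Z) (hind : Indep (MeasurableSpace.comap Z inferInstance) m μ)
    {Y : Ω → S} (hY : Measurable[m] Y) {Φ : S × T → ℝ≥0∞} (hΦ : Measurable Φ) :
    ∫⁻ ω, Φ (Y ω, Z ω) ∂μ = ∫⁻ ω, ∫⁻ z, Φ (Y ω, z) ∂(μ.map Z) ∂μ := by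
  have hY' : Measurable Y := hY.mono hm le_rfl
  have hi : IndepFun Y Z μ :=
    (IndepFun_iff_Indep _ _ _).2 (indep_of_indep_of_le_left hind.symm hY.comap_le)
  have := (indepFun_iff_map_prod_eq_prod_map_map hY'.aemeasurable hZ.aemeasurable).1 hi
  rw [← lintegral_map hΦ (hY'.prodMk hZ), this]
  have : IsProbabilityMeasure (μ.map Z) := Measure.isProbabilityMeasure_map hZ.aemeasurable
  rw [lintegral_prod _ hΦ.aemeasurable, lintegral_map hΦ.lintegral_prod_right' hY']

variable {Ω : Type*} {d : ℕ}

/-- The path of `X` with the counts from time `t` on replaced by `0`. -/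
def truncPath (X : ℕ → Ω → Fin d → ℕ) (t : ℕ) (ω : Ω) : ℕ → Fin d → ℕ :=
  fun s => if s < t then X s ω else 0

lemma truncPath_succ (X : ℕ → Ω → Fin d → ℕ) (t : ℕ) (ω : Ω) :
    truncPath X (t + 1) ω = Function.update (truncPath X t ω) t (X t ω) := by
  ext1 s
  by_cases h : s = t
  · subst h; simp [truncPath]
  · have : s < t + 1 ↔ s < t := by omega
    simp [truncPath, h, this]

lemma measurable_truncPath {m : MeasurableSpace Ω} {X : ℕ → Ω → Fin d → ℕ} {t : ℕ}
    (h : ∀ s < t, Measurable (X s)) : Measurable (truncPath X t) := by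
  refine measurable_pi_iff.2 fun s => ?_
  by_cases hs : s < t
  · simpa [truncPath, hs] using h s hs
  · simp [truncPath, hs]

lemma pastSigma_le {E : Type*} [MeasurableSpace E] {mΩ : MeasurableSpace Ω} {X : ℕ → Ω → E}
    (hX : ∀ t, Measurable (X t)) (k : ℕ) : pastSigma X k ≤ mΩ :=
  iSup₂_le fun j _ => (hX j).comap_le

lemma pastSigma_mono {E : Type*} [MeasurableSpace E] (X : ℕ → Ω → E) :
    Monotone (pastSigma X) :=
  fun _ _ hkl => iSup₂_le fun j hj => le_iSup₂_of_le j (hj.trans hkl) le_rfl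

lemma measurable_pastSigma {E : Type*} [MeasurableSpace E] (X : ℕ → Ω → E) {j k : ℕ}
    (h : j ≤ k) : Measurable[pastSigma X k] (X j) :=
  measurable_iff_comap_le.2 (le_iSup₂_of_le j h le_rfl)

section History

variable (lam : ℕ → Ω → Fin d → ℝ≥0) (X : ℕ → Ω → Fin d → ℕ) (Z : ℕ → Ω → Fin d → ℝ≥0)

lemma history_mono : Monotone (history lam X Z) := fun _ _ h =>
  sup_le_sup (sup_le_sup le_rfl (pastSigma_mono X h)) (pastSigma_mono Z h)

lemma pastSigma_le_history (t : ℕ) : pastSigma X t ≤ history lam X Z t :=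
  le_sup_right.trans le_sup_left

lemma measurable_history_counts {s t : ℕ} (h : s ≤ t) : Measurable[history lam X Z t] (X s) :=
  (measurable_pastSigma X h).mono (pastSigma_le_history lam X Z t) le_rfl

lemma measurable_history_covariates {s t : ℕ} (h : s ≤ t) : Measurable[history lam X Z t] (Z s) :=
  (measurable_pastSigma Z h).mono le_sup_right le_rfl

end History

section CleanIntensity

/-- The intensity process computed from its initial value by the recursion. -/
def recIntensity (A B : Matrix (Fin d) (Fin d) ℝ≥0) (lam₀ : Ω → Fin d → ℝ≥0)
    (X : ℕ → Ω → Fin d → ℕ) (Z : ℕ → Ω → Fin d → ℝ≥0) : ℕ → Ω → Fin d → ℝ≥0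
  | 0 => lam₀
  | t + 1 => fun ω => A *ᵥ recIntensity A B lam₀ X Z t ω + B *ᵥ (fun j => (X t ω j : ℝ≥0)) + Z t ω

variable {A B : Matrix (Fin d) (Fin d) ℝ≥0} {lam : ℕ → Ω → Fin d → ℝ≥0}
  {X : ℕ → Ω → Fin d → ℕ} {Z : ℕ → Ω → Fin d → ℝ≥0}

lemma measurable_recursion {m : MeasurableSpace Ω} {l z : Ω → Fin d → ℝ≥0} {x : Ω → Fin d → ℕ}
    (hl : Measurable l) (hx : Measurable x) (hz : Measurable z) :
    Measurable fun ω => A *ᵥ l ω + B *ᵥ (fun j => (x ω j : ℝ≥0)) + z ω :=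
  (((measurable_mulVec A).comp hl).add ((measurable_mulVec B).comp
    ((Measurable.of_discrete (f := fun (x : Fin d → ℕ) j => (x j : ℝ≥0))).comp hx))).add hz

lemma measurable_recIntensity {m : MeasurableSpace Ω} {t : ℕ} (h0 : Measurable (lam 0))
    (hX : ∀ s < t, Measurable (X s)) (hZ : ∀ s < t, Measurable (Z s)) :
    Measurable (recIntensity A B (lam 0) X Z t) := by
  induction t with
  | zero => exact h0
  | succ t ih =>
    exact measurable_recursion (ih (fun s hs => hX s (by omega)) fun s hs => hZ s (by omega))
      (hX t (by omega)) (hZ t (by omega))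

lemma measurable_history_recIntensity (t : ℕ) :
    Measurable[history lam X Z t] (recIntensity A B (lam 0) X Z (t + 1)) :=
  @measurable_recIntensity Ω d A B lam X Z (history lam X Z t) (t + 1)
    (measurable_iff_comap_le.2 (le_sup_left.trans le_sup_left))
    (fun _ hs => measurable_history_counts lam X Z (by omega))
    (fun _ hs => measurable_history_covariates lam X Z (by omega))

lemma IsPoissonINGARCH.ae_eq_recIntensity [MeasurableSpace Ω] {μ : Measure Ω}
    (h : IsPoissonINGARCH μ A B lam X Z) (t : ℕ) :
    recIntensity A B (lam 0) X Z t =ᵐ[μ] lam t := by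
  induction t with
  | zero => rfl
  | succ t ih =>
    filter_upwards [ih, h.recursion t] with ω h1 h2
    rw [h2, ← h1]
    rfl

lemma IsPoissonINGARCH.history_le [mΩ : MeasurableSpace Ω] {μ : Measure Ω}
    (h : IsPoissonINGARCH μ A B lam X Z) (t : ℕ) : history lam X Z t ≤ mΩ :=
  sup_le (sup_le (h.measurable_lam 0).comap_le (pastSigma_le h.measurable_X t))
    (pastSigma_le h.measurable_Z t)

/-- The intensities may be replaced by the version for which the recursion holds everywhere. -/
lemma IsPoissonINGARCH.to_recIntensity [MeasurableSpace Ω] {μ : Measure Ω}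
    (h : IsPoissonINGARCH μ A B lam X Z) :
    IsPoissonINGARCH μ A B (recIntensity A B (lam 0) X Z) X Z where
  measurable_lam t := measurable_recIntensity (h.measurable_lam 0) (fun s _ => h.measurable_X s)
    fun s _ => h.measurable_Z s
  measurable_X := h.measurable_X
  measurable_Z := h.measurable_Z
  condLaw t C hC := by
    -- `history` involves `lam` only at time 0, where the new version agrees, so the conditioning
    -- σ-algebra is unchanged.
    refine (h.condLaw t C hC).trans ?_
    filter_upwards [h.ae_eq_recIntensity (t + 1)] with ω hω
    rw [hω]
  recursion t := ae_of_all _ fun ω => rfl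
  iIndep_Z := h.iIndep_Z
  indep_Z := h.indep_Z

variable [mΩ : MeasurableSpace Ω] {μ : Measure Ω} [IsProbabilityMeasure μ]

/-- Splitting over the countably many values `x` of the count leaves a history-measurable factor on
each event. -/
lemma IsPoissonINGARCH.lintegral_counts (h : IsPoissonINGARCH μ A B lam X Z) (t : ℕ)
    {Φ : Ω → (Fin d → ℕ) → ℝ≥0∞} (hΦ : ∀ x, Measurable[history lam X Z t] fun ω => Φ ω x) :
    ∫⁻ ω, Φ ω (X (t + 1) ω) ∂μ = ∫⁻ ω, ∫⁻ x, Φ ω x ∂(poissonVec (lam (t + 1) ω)) ∂μ := by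
  have hm := h.history_le t
  have hΦ' : ∀ x, Measurable fun ω => Φ ω x := fun x => (hΦ x).mono hm le_rfl
  have hp : ∀ x, Measurable fun ω => poissonVec (lam (t + 1) ω) {x} := fun x =>
    (measurable_poissonVec_singleton x).comp (h.measurable_lam (t + 1))
  have hS : ∀ x, MeasurableSet (X (t + 1) ⁻¹' {x}) := fun x =>
    h.measurable_X (t + 1) (measurableSet_singleton x)
  simp_rw [lintegral_countable']
  have e : ∀ ω, Φ ω (X (t + 1) ω)
      = ∑' x, (X (t + 1) ⁻¹' {x}).indicator (fun ω => Φ ω x) ω := by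
    intro ω
    rw [tsum_eq_single (X (t + 1) ω)]
    · simp
    · intro x hx
      exact Set.indicator_of_notMem (fun h' => hx h'.symm) _
  simp_rw [e]
  rw [lintegral_tsum fun x => ((hΦ' x).indicator (hS x)).aemeasurable,
    lintegral_tsum (f := fun x ω => Φ ω x * poissonVec (lam (t + 1) ω) {x})
      fun x => ((hΦ' x).mul (hp x)).aemeasurable]
  congr with x
  rw [lintegral_indicator (hS x)]
  exact setLIntegral_eq_lintegral_mul_of_sub_sigma hm (hp x)
    (fun D hD => measure_inter_eq_setLIntegral_of_condExp hm (hS x) (hp x)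
      (fun ω => prob_le_one) (h.condLaw t {x} (measurableSet_singleton x)) hD) (hΦ x)

/-- Expectations of functionals of the counts are expectations of the value function. -/
lemma IsPoissonINGARCH.lintegral_mul_truncPath (h : IsPoissonINGARCH μ A B lam X Z)
    (hlam : ∀ t, Measurable[history lam X Z t] (lam (t + 1)))
    (hrec : ∀ t ω, lam (t + 1) ω
      = A *ᵥ lam t ω + B *ᵥ (fun j => (X t ω j : ℝ≥0)) + Z t ω)
    {g : (ℕ → Fin d → ℕ) → ℝ≥0∞} (hg : Measurable g) (n : ℕ) :
    ∀ (t : ℕ) (u : Ω → ℝ≥0∞), Measurable[history lam X Z t] u →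
      ∫⁻ ω, u ω * g (truncPath X (t + 1 + n) ω) ∂μ
        = ∫⁻ ω, u ω * condValue A B (fun s => μ.map (Z s)) g n (t + 1) (truncPath X (t + 1) ω)
            (lam (t + 1) ω) ∂μ := by
  have hprob : ∀ s, IsProbabilityMeasure (μ.map (Z s)) := fun s =>
    Measure.isProbabilityMeasure_map (h.measurable_Z s).aemeasurable
  have hV := fun n t => measurable_condValue (A := A) (B := B) (ν := fun s => μ.map (Z s)) hg n t
  induction n with
  | zero => intro t u _; rfl
  | succ n ih =>
    intro t u hu
    -- Integration runs backwards in time: the induction hypothesis removes the counts after `t +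
    -- 1`, independence removes `Z (t + 1)`, and the conditional law removes `X (t + 1)`.
    rw [show t + 1 + (n + 1) = t + 1 + 1 + n by ring,
      ih (t + 1) u (hu.mono (history_mono lam X Z (Nat.le_succ t)) le_rfl)]
    have hle : history lam X Z t ≤ history lam X Z t
        ⊔ MeasurableSpace.comap (X (t + 1)) inferInstance := le_sup_left
    have hle' : history lam X Z t ⊔ MeasurableSpace.comap (X (t + 1)) inferInstance ≤ mΩ :=
      sup_le (h.history_le t) (h.measurable_X (t + 1)).comap_le
    have hXm : Measurable[history lam X Z t ⊔ MeasurableSpace.comap (X (t + 1)) inferInstance]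
        (X (t + 1)) := measurable_iff_comap_le.2 le_sup_right
    have hT : Measurable[history lam X Z t] (truncPath X (t + 1)) :=
      @measurable_truncPath Ω d (history lam X Z t) X (t + 1)
        fun s hs => measurable_history_counts lam X Z (by omega)
    have hT' : Measurable[history lam X Z t ⊔ MeasurableSpace.comap (X (t + 1)) inferInstance]
        (truncPath X (t + 1 + 1)) := by
      refine @measurable_truncPath Ω d (_ ⊔ _) X (t + 1 + 1) fun s hs => ?_
      rcases Nat.lt_succ_iff_lt_or_eq.1 hs with hs | rfl
      · exact (measurable_history_counts lam X Z (by omega)).mono hle le_rfl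
      · exact hXm
    have hI : Measurable[history lam X Z t ⊔ MeasurableSpace.comap (X (t + 1)) inferInstance]
        fun ω => A *ᵥ lam (t + 1) ω + B *ᵥ (fun j => (X (t + 1) ω j : ℝ≥0)) := by
      have := @measurable_recursion Ω d A B
        (history lam X Z t ⊔ MeasurableSpace.comap (X (t + 1)) inferInstance)
        (lam (t + 1)) (fun _ => 0) (X (t + 1)) ((hlam t).mono hle le_rfl) hXm
        (@measurable_const _ _ _ (_) _)
      simpa only [add_zero] using this
    have hΦ : Measurable fun q : (ℝ≥0∞ × (ℕ → Fin d → ℕ) × (Fin d → ℝ≥0)) × (Fin d → ℝ≥0) =>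
        q.1.1 * condValue A B (fun s => μ.map (Z s)) g n (t + 1 + 1) q.1.2.1 (q.1.2.2 + q.2) := by
      have h1 : Measurable fun q : (ℝ≥0∞ × (ℕ → Fin d → ℕ) × (Fin d → ℝ≥0)) × (Fin d → ℝ≥0) =>
          (q.1.2.1, q.1.2.2 + q.2) :=
        (measurable_fst.comp (measurable_snd.comp measurable_fst)).prodMk
          ((measurable_snd.comp (measurable_snd.comp measurable_fst)).add measurable_snd)
      exact (measurable_fst.comp measurable_fst).mul ((hV n (t + 1 + 1)).comp h1)
    have hVz : ∀ ξ l, Measurable fun z => condValue A B (fun s => μ.map (Z s)) g n (t + 1 + 1) ξ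
        (l + z) := fun ξ l =>
      (hV n (t + 1 + 1)).comp (measurable_const.prodMk (measurable_id.const_add l))
    have hZstep := lintegral_comp_prodMk_of_indep hle' (h.measurable_Z (t + 1)) (h.indep_Z t)
      ((hu.mono hle le_rfl).prodMk (hT'.prodMk hI)) hΦ
    simp only at hZstep
    rw [show (∫⁻ ω, u ω * condValue A B (fun s => μ.map (Z s)) g n (t + 1 + 1)
      (truncPath X (t + 1 + 1) ω) (lam (t + 1 + 1) ω) ∂μ) = _ from
      lintegral_congr fun ω => by rw [hrec (t + 1)], hZstep]
    have hXstep := h.lintegral_counts t (Φ := fun ω x => ∫⁻ z, u ω *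
      condValue A B (fun s => μ.map (Z s)) g n (t + 1 + 1)
        (Function.update (truncPath X (t + 1) ω) (t + 1) x)
        (A *ᵥ lam (t + 1) ω + B *ᵥ (fun j => (x j : ℝ≥0)) + z) ∂(μ.map (Z (t + 1)))) fun x => by
      have hI' : Measurable fun l : Fin d → ℝ≥0 => A *ᵥ l + B *ᵥ (fun j => (x j : ℝ≥0)) :=
        (measurable_mulVec A).add_const _
      exact hΦ.lintegral_prod_right'.comp (hu.prodMk
        (((measurable_update_path (t + 1) x).comp hT).prodMk (hI'.comp (hlam t))))
    simp_rw [truncPath_succ X (t + 1)]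
    rw [hXstep]
    refine lintegral_congr fun ω => ?_
    rw [condValue, ← lintegral_const_mul _ Measurable.of_discrete]
    refine lintegral_congr fun x => ?_
    rw [lintegral_const_mul _ (hVz _ _)]

end CleanIntensity

end

noncomputable section

/-! ### Powers of matrices with small spectral radius -/

/-- Gelfand's formula gives the bound with constant 1 from some exponent on; the constant absorbs
the finitely many earlier powers. -/
lemma exists_nnnorm_pow_le_of_spectralRadius_lt {R : Type*} [NormedRing R] [NormedAlgebra ℂ R]
    [CompleteSpace R] {a : R} {κ : ℝ≥0} (h : spectralRadius ℂ a < κ) :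
    ∃ C : ℝ≥0, ∀ n : ℕ, ‖a ^ n‖₊ ≤ C * κ ^ n := by
  have hκ : 0 < κ := ENNReal.coe_pos.1 ((zero_le).trans_lt h)
  have hev := (spectrum.pow_nnnorm_pow_one_div_tendsto_nhds_spectralRadius a).eventually_lt_const h
  obtain ⟨N, hN⟩ := eventually_atTop.1 hev
  refine ⟨1 + ∑ n ∈ Finset.range (N + 1), ‖a ^ n‖₊ / κ ^ n, fun n => ?_⟩
  by_cases hn : n < N + 1
  · have h1 : ‖a ^ n‖₊ / κ ^ n ≤ 1 + ∑ n ∈ Finset.range (N + 1), ‖a ^ n‖₊ / κ ^ n :=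
      (Finset.single_le_sum (f := fun n => ‖a ^ n‖₊ / κ ^ n) (fun _ _ => zero_le)
        (Finset.mem_range.2 hn)).trans le_add_self
    rwa [div_le_iff₀ (pow_pos hκ n)] at h1
  · have h1 := (hN n (by omega)).le
    have hn0 : (n : ℝ) ≠ 0 := by
      have : 0 < n := by omega
      positivity
    have h2 := ENNReal.rpow_le_rpow h1 (Nat.cast_nonneg n)
    rw [← ENNReal.rpow_mul, one_div_mul_cancel hn0, ENNReal.rpow_one, ENNReal.rpow_natCast] at h2
    have h3 : ‖a ^ n‖₊ ≤ κ ^ n := by exact_mod_cast h2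
    exact h3.trans (le_mul_of_one_le_left zero_le le_self_add)

variable {d : ℕ}

lemma sqrtMatrix_eq_map (A B : Matrix (Fin d) (Fin d) ℝ≥0) :
    sqrtMatrix A B = (Complex.ofRealHom.comp NNReal.toRealHom).mapMatrix (sqrtMatrixNN A B) := by
  ext i j
  simp [sqrtMatrix, sqrtMatrixNN, two_mul]

lemma exists_sqrtMatrixNN_pow_le {A B : Matrix (Fin d) (Fin d) ℝ≥0} {κ : ℝ≥0}
    (h : rhoSqrt A B < κ) :
    ∃ C : ℝ≥0, ∀ (n : ℕ) (i j : Fin d), (sqrtMatrixNN A B ^ n) i j ≤ C * κ ^ n := by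
  let : NormedRing (Matrix (Fin d) (Fin d) ℂ) := Matrix.linftyOpNormedRing
  let : NormedAlgebra ℂ (Matrix (Fin d) (Fin d) ℂ) := Matrix.linftyOpNormedAlgebra
  have : CompleteSpace (Matrix (Fin d) (Fin d) ℂ) := FiniteDimensional.complete ℂ _
  obtain ⟨C, hC⟩ := exists_nnnorm_pow_le_of_spectralRadius_lt (a := sqrtMatrix A B) h
  refine ⟨C, fun n i j => le_trans ?_ (hC n)⟩
  rw [sqrtMatrix_eq_map, ← map_pow, Matrix.linfty_opNNNorm_def]
  refine le_trans ?_ (Finset.le_sup (Finset.mem_univ i))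
  refine le_trans ?_ (Finset.single_le_sum (fun _ _ => zero_le) (Finset.mem_univ j))
  rw [RingHom.mapMatrix_apply, Matrix.map_apply]
  simp

lemma sum_range_geometric_le {κ : ℝ≥0} (hκ : κ < 1) (n : ℕ) :
    ∑ i ∈ Finset.range n, κ ^ i ≤ (1 - κ)⁻¹ := by
  rw [← NNReal.tsum_geometric hκ]
  exact (NNReal.summable_geometric hκ).sum_le_tsum _ fun _ _ => zero_le

/-- The bound does not depend on the window length `n`, which allows passage to the infinite future.
-/
lemma lipWeight_le {M : Matrix (Fin d) (Fin d) ℝ≥0} {C κ : ℝ≥0} (hκ : κ < 1)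
    (hC : ∀ (n : ℕ) (i j : Fin d), (M ^ n) i j ≤ C * κ ^ n) (n j : ℕ) (i : Fin d) :
    lipWeight M n j i ≤ d * 2 * C * (1 - κ)⁻¹ * κ ^ j := by
  have h1 : ∀ k, ((fun _ => (2 : ℝ≥0)) ᵥ* M ^ (k + j)) i ≤ d * 2 * C * κ ^ j * κ ^ k := by
    intro k
    simp only [Matrix.vecMul, dotProduct]
    refine (Finset.sum_le_sum fun l _ => mul_le_mul_right (hC (k + j) l i) 2).trans (le_of_eq ?_)
    rw [Finset.sum_const, Finset.card_univ, Fintype.card_fin, nsmul_eq_mul, pow_add]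
    ring
  rw [lipWeight, Finset.sum_apply]
  refine (Finset.sum_le_sum fun k _ => h1 k).trans ?_
  rw [← Finset.mul_sum]
  calc _ ≤ d * 2 * C * κ ^ j * (1 - κ)⁻¹ := by gcongr; exact sum_range_geometric_le hκ n
    _ = _ := by ring

/-- Iterates of an affine map with a contracting linear part stay bounded. -/
lemma exists_bound_affine_iterate {M : Matrix (Fin d) (Fin d) ℝ≥0} {C κ : ℝ≥0} (hκ : κ < 1)
    (hC : ∀ (n : ℕ) (i j : Fin d), (M ^ n) i j ≤ C * κ ^ n) {v : ℕ → Fin d → ℝ≥0}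
    {r : Fin d → ℝ≥0} (hv : ∀ t, v (t + 1) = M *ᵥ v t + r) : ∃ K : ℝ≥0, ∀ t i, v t i ≤ K := by
  have hsol : ∀ t, v t = M ^ t *ᵥ v 0 + ∑ s ∈ Finset.range t, M ^ s *ᵥ r := by
    intro t
    induction t with
    | zero => simp
    | succ t ih =>
      rw [hv, ih, Matrix.mulVec_add, Matrix.mulVec_mulVec, ← pow_succ', Finset.sum_range_succ',
        Matrix.mulVec_sum, add_assoc]
      simp only [Matrix.mulVec_mulVec, ← pow_succ', pow_zero, Matrix.one_mulVec]
  have hb : ∀ (t : ℕ) (w : Fin d → ℝ≥0) i, (M ^ t *ᵥ w) i ≤ C * (∑ j, w j) * κ ^ t := by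
    intro t w i
    simp only [Matrix.mulVec, dotProduct]
    refine (Finset.sum_le_sum fun j _ => mul_le_mul_left (hC t i j) (w j)).trans (le_of_eq ?_)
    rw [← Finset.mul_sum]
    ring
  refine ⟨C * (∑ j, v 0 j) + C * (∑ j, r j) * (1 - κ)⁻¹, fun t i => ?_⟩
  rw [hsol, Pi.add_apply, Finset.sum_apply]
  refine add_le_add ((hb t _ i).trans (mul_le_of_le_one_right zero_le
    (pow_le_one₀ zero_le hκ.le))) ((Finset.sum_le_sum fun s _ => hb s r i).trans ?_)
  rw [← Finset.mul_sum]
  gcongr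
  exact sum_range_geometric_le hκ t

/-! ### Deviations of the intensities from a deterministic sequence -/

/-- The deterministic sequence around which the intensities concentrate on the square-root scale. -/
def centre (A B : Matrix (Fin d) (Fin d) ℝ≥0) (z : ℕ → Fin d → ℝ≥0) : ℕ → Fin d → ℝ≥0
  | 0 => 0
  | t + 1 => A *ᵥ centre A B z t + B *ᵥ centre A B z t + z t

variable {Ω : Type*} {A B : Matrix (Fin d) (Fin d) ℝ≥0} {lam : ℕ → Ω → Fin d → ℝ≥0}
  {X : ℕ → Ω → Fin d → ℕ} {Z : ℕ → Ω → Fin d → ℝ≥0} [mΩ : MeasurableSpace Ω] {μ : Measure Ω}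

lemma lintegral_mulVec_le {M : Matrix (Fin d) (Fin d) ℝ≥0} {f : Ω → Fin d → ℝ≥0}
    (hf : Measurable f) {v : Fin d → ℝ≥0} (hv : ∀ j, ∫⁻ ω, (f ω j : ℝ≥0∞) ∂μ ≤ v j) (i : Fin d) :
    ∫⁻ ω, ((M *ᵥ f ω) i : ℝ≥0∞) ∂μ ≤ ((M *ᵥ v) i : ℝ≥0) := by
  simp only [Matrix.mulVec, dotProduct]
  push_cast
  have hf' : ∀ j, Measurable fun ω => (f ω j : ℝ≥0∞) := fun j =>
    ((measurable_pi_apply j).comp hf).coe_nnreal_ennreal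
  rw [lintegral_finsetSum _ fun j _ => (hf' j).const_mul _]
  refine Finset.sum_le_sum fun j _ => ?_
  rw [lintegral_const_mul _ (hf' j)]
  gcongr
  exact hv j

lemma measurable_sqrtDistVec_const {f : Ω → Fin d → ℝ≥0} (hf : Measurable f) (c : Fin d → ℝ≥0) :
    Measurable fun ω => sqrtDistVec (f ω) c :=
  measurable_pi_iff.2 fun j => ((measurable_pi_apply j).comp hf).sqrtDist measurable_const

/-- Through λ_t, the counts are within `b + v t` of the centre in mean. The next bound √A v + √B (b
+ v) + ζ is at most M v + (√B b + ζ), an affine iteration that stays bounded. -/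
lemma exists_bound_lintegral_sqrtDist_centre (hX : ∀ t, Measurable (X t))
    (hZ : ∀ t, Measurable (Z t)) (hl : ∀ t, Measurable (lam t))
    (hrec : ∀ t ω, lam (t + 1) ω
      = A *ᵥ lam t ω + B *ᵥ (fun j => (X t ω j : ℝ≥0)) + Z t ω)
    {C κ : ℝ≥0} (hκ : κ < 1)
    (hC : ∀ (n : ℕ) (i j : Fin d), (sqrtMatrixNN A B ^ n) i j ≤ C * κ ^ n)
    {z : ℕ → Fin d → ℝ≥0} {b m₀ ζ : Fin d → ℝ≥0}
    (hb : ∀ t j, ∫⁻ ω, (sqrtDist (X t ω j) (lam t ω j) : ℝ≥0∞) ∂μ ≤ b j)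
    (h0 : ∀ j, ∫⁻ ω, (sqrtDist (lam 0 ω j) 0 : ℝ≥0∞) ∂μ ≤ m₀ j)
    (hζ : ∀ t j, ∫⁻ ω, (sqrtDist (Z t ω j) (z t j) : ℝ≥0∞) ∂μ ≤ ζ j) :
    ∃ K : ℝ≥0, ∀ t i, ∫⁻ ω, (sqrtDist (lam t ω i) (centre A B z t i) : ℝ≥0∞) ∂μ ≤ K := by
  let v : ℕ → Fin d → ℝ≥0 := fun t => Nat.rec m₀
    (fun _ w => sqrtMatrixNN A B *ᵥ w + (B.map NNReal.sqrt *ᵥ b + ζ)) t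
  obtain ⟨K, hK⟩ := exists_bound_affine_iterate hκ hC (v := v) fun t => rfl
  refine ⟨K, fun t i => le_trans ?_ (ENNReal.coe_le_coe.2 (hK t i))⟩
  induction t generalizing i with
  | zero => exact h0 i
  | succ t ih =>
    have hXm : Measurable fun ω => (fun j => (X t ω j : ℝ≥0) : Fin d → ℝ≥0) :=
      (Measurable.of_discrete (f := fun (x : Fin d → ℕ) j => (x j : ℝ≥0))).comp (hX t)
    have hXc : ∀ j, ∫⁻ ω, (sqrtDistVec (fun j => (X t ω j : ℝ≥0)) (centre A B z t) j : ℝ≥0∞) ∂μ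
        ≤ ((b + v t) j : ℝ≥0) := by
      intro j
      have hm : Measurable fun ω => (sqrtDist (X t ω j) (lam t ω j) : ℝ≥0∞) :=
        (((measurable_pi_apply j).comp hXm).sqrtDist
          ((measurable_pi_apply j).comp (hl t))).coe_nnreal_ennreal
      refine (lintegral_mono fun ω => ENNReal.coe_le_coe.2
        (sqrtDist_triangle _ (lam t ω j) _)).trans ?_
      push_cast
      rw [lintegral_add_left hm]
      exact add_le_add (hb t j) (ih j)
    have hA := lintegral_mulVec_le (M := A.map NNReal.sqrt)
      (measurable_sqrtDistVec_const (hl t) (centre A B z t)) ih i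
    have hB := lintegral_mulVec_le (M := B.map NNReal.sqrt)
      (measurable_sqrtDistVec_const hXm (centre A B z t)) hXc i
    have hpt : ∀ ω, (sqrtDist (lam (t + 1) ω i) (centre A B z (t + 1) i) : ℝ≥0∞)
        ≤ ((A.map NNReal.sqrt *ᵥ sqrtDistVec (lam t ω) (centre A B z t)) i : ℝ≥0)
          + ((B.map NNReal.sqrt *ᵥ sqrtDistVec (fun j => (X t ω j : ℝ≥0))
            (centre A B z t)) i : ℝ≥0) + (sqrtDist (Z t ω i) (z t i) : ℝ≥0) := by
      intro ω
      have := sqrtDistVec_recursion_le A B (lam t ω) (centre A B z t)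
        (fun j => (X t ω j : ℝ≥0)) (centre A B z t) (Z t ω) (z t) i
      rw [← hrec] at this
      exact_mod_cast this
    have hmA : Measurable fun ω => (((A.map NNReal.sqrt *ᵥ sqrtDistVec (lam t ω)
        (centre A B z t)) i : ℝ≥0) : ℝ≥0∞) :=
      ((measurable_pi_apply i).comp ((measurable_mulVec _).comp
        (measurable_sqrtDistVec_const (hl t) _))).coe_nnreal_ennreal
    have hmZ : Measurable fun ω => (sqrtDist (Z t ω i) (z t i) : ℝ≥0∞) :=
      (((measurable_pi_apply i).comp (hZ t)).sqrtDist measurable_const).coe_nnreal_ennreal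
    refine (lintegral_mono hpt).trans ?_
    rw [lintegral_add_right _ hmZ, lintegral_add_left hmA]
    refine (add_le_add (add_le_add hA hB) (hζ t i)).trans ?_
    norm_cast
    change _ ≤ (sqrtMatrixNN A B *ᵥ v t + (B.map NNReal.sqrt *ᵥ b + ζ)) i
    simp only [sqrtMatrixNN, Matrix.add_mulVec, Matrix.mulVec_add, Pi.add_apply, two_nsmul]
    calc _ = (A.map NNReal.sqrt *ᵥ v t) i + (B.map NNReal.sqrt *ᵥ v t) i
          + ((B.map NNReal.sqrt *ᵥ b) i + ζ i) := by ring
      _ ≤ _ := by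
        gcongr
        exact le_self_add

end

noncomputable section

/-! ### Bounds for the coefficient of absolute regularity -/

section Beta

variable {Ω : Type*} {m₁ m₂ : MeasurableSpace Ω} [mΩ : MeasurableSpace Ω] {μ : Measure Ω}
  [IsProbabilityMeasure μ]

lemma condExp_sub_const_le_of_forall_setIntegral_le (hm₁ : m₁ ≤ mΩ) {f G : Ω → ℝ}
    (hf : Integrable f μ) (hG : Integrable G μ) {c : ℝ}
    (h : ∀ D, MeasurableSet[m₁] D → ∫ ω in D, f ω ∂μ - μ.real D * c ≤ ∫ ω in D, G ω ∂μ) :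
    (fun ω => (μ[f | m₁]) ω - c) ≤ᵐ[μ] μ[G | m₁] := by
  have hfm : StronglyMeasurable[m₁] fun ω => (μ[f | m₁]) ω - c :=
    stronglyMeasurable_condExp.sub stronglyMeasurable_const
  have hfi : Integrable (fun ω => (μ[f | m₁]) ω - c) μ :=
    integrable_condExp.sub (integrable_const c)
  refine ae_le_of_ae_le_trim (hm := hm₁) (ae_le_of_forall_setIntegral_le
    (hfi.trim hm₁ hfm) (integrable_condExp.trim hm₁ stronglyMeasurable_condExp) fun D hD _ => ?_)
  rw [← setIntegral_trim hm₁ hfm hD, ← setIntegral_trim hm₁ stronglyMeasurable_condExp hD,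
    setIntegral_condExp hm₁ hG hD, integral_sub integrable_condExp.integrableOn
      (integrable_const c).integrableOn, setIntegral_condExp hm₁ hf hD, setIntegral_const,
    smul_eq_mul]
  exact h D hD

/-- Since `f` need not be `m₁`-measurable, the dominating function is its conditional expectation,
which has the same integral. -/
lemma betaCoeff_le_lintegral (hm₁ : m₁ ≤ mΩ) (hm₂ : m₂ ≤ mΩ) {f : Ω → ℝ≥0∞} (hf : Measurable f)
    (hfin : ∫⁻ ω, f ω ∂μ ≠ ∞)
    (h : ∀ B D, MeasurableSet[m₂] B → MeasurableSet[m₁] D →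
      μ (D ∩ B) ≤ μ D * μ B + ∫⁻ ω in D, f ω ∂μ) :
    betaCoeff m₁ m₂ μ ≤ ∫⁻ ω, f ω ∂μ := by
  have hG : Integrable (fun ω => (f ω).toReal) μ := integrable_toReal_of_lintegral_ne_top
    hf.aemeasurable hfin
  have hG0 : 0 ≤ᵐ[μ] fun ω => (f ω).toReal := ae_of_all _ fun ω => ENNReal.toReal_nonneg
  have hlt : ∀ᵐ ω ∂μ, f ω < ∞ := ae_lt_top hf hfin
  have hint : ∀ D, ∫ ω in D, (f ω).toReal ∂μ = (∫⁻ ω in D, f ω ∂μ).toReal := fun D =>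
    integral_toReal hf.aemeasurable (ae_restrict_of_ae hlt)
  have hfinD : ∀ D, ∫⁻ ω in D, f ω ∂μ ≠ ∞ := fun D =>
    ((setLIntegral_le_lintegral D f).trans_lt hfin.lt_top).ne
  have hreal : ∀ B D, MeasurableSet[m₂] B → MeasurableSet[m₁] D →
      μ.real (D ∩ B) - μ.real D * μ.real B ≤ ∫ ω in D, (f ω).toReal ∂μ := by
    intro B D hB hD
    have hmul : μ D * μ B ≠ ∞ := ENNReal.mul_ne_top (measure_ne_top _ _) (measure_ne_top _ _)
    have := ENNReal.toReal_mono (ENNReal.add_ne_top.2 ⟨hmul, hfinD D⟩) (h B D hB hD)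
    rw [ENNReal.toReal_add hmul (hfinD D), ENNReal.toReal_mul, ← hint] at this
    simp only [Measure.real]
    linarith
  refine le_trans (b := ∫⁻ ω, ENNReal.ofReal ((μ[fun ω => (f ω).toReal | m₁]) ω) ∂μ) ?_
    (le_of_eq ?_)
  · unfold betaCoeff
    refine iInf_le_of_le (fun ω => ENNReal.ofReal ((μ[fun ω => (f ω).toReal | m₁]) ω))
      (iInf_le_of_le ((stronglyMeasurable_condExp.mono hm₁).measurable.ennreal_ofReal)
        (iInf_le_of_le (fun B hB => ?_) le_rfl))
    have hBm := hm₂ B hB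
    have hi : Integrable (B.indicator (fun _ => (1 : ℝ))) μ := (integrable_const 1).indicator hBm
    have hval : ∀ D, ∫ ω in D, B.indicator (fun _ => (1 : ℝ)) ω ∂μ = μ.real (D ∩ B) := by
      intro D
      rw [integral_indicator hBm, setIntegral_const, smul_eq_mul, mul_one, Measure.real,
        Measure.restrict_apply hBm, Set.inter_comm, Measure.real]
    have up := condExp_sub_const_le_of_forall_setIntegral_le hm₁ hi hG (c := μ.real B)
      fun D hD => by rw [hval]; exact hreal B D hB hD
    -- The one-sided hypothesis applied to the complement of `B` gives the other sign.
    have low := condExp_sub_const_le_of_forall_setIntegral_le hm₁ hi.neg hG (c := -μ.real B)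
      fun D hD => by
        have hc := hreal Bᶜ D hB.compl hD
        have h1 : μ.real (D ∩ Bᶜ) = μ.real D - μ.real (D ∩ B) := by
          have := measureReal_inter_add_sdiff (μ := μ) (s := D) hBm
          rw [← Set.sdiff_eq]
          linarith
        have h2 := probReal_compl_eq_one_sub (μ := μ) hBm
        simp only [Pi.neg_apply]
        rw [integral_neg, hval]
        rw [h1, h2] at hc
        linarith
    filter_upwards [up, low, condExp_neg (μ := μ) (B.indicator (fun _ => (1 : ℝ))) m₁]
      with ω h1 h2 h3
    refine ENNReal.ofReal_le_ofReal (abs_le.2 ⟨?_, h1⟩)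
    rw [h3, Pi.neg_apply] at h2
    linarith
  · rw [← ofReal_integral_eq_lintegral_ofReal integrable_condExp (condExp_nonneg hG0),
      integral_condExp hm₁, integral_toReal hf.aemeasurable hlt, ENNReal.ofReal_toReal hfin]

lemma betaCoeff_le_one (hm₁ : m₁ ≤ mΩ) (hm₂ : m₂ ≤ mΩ) : betaCoeff m₁ m₂ μ ≤ 1 := by
  have := betaCoeff_le_lintegral (μ := μ) hm₁ hm₂ (f := fun _ => 1) measurable_const (by simp)
    fun B D _ _ => by
      rw [setLIntegral_one]
      exact (measure_mono Set.inter_subset_left).trans le_add_self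
  simpa using this

/-- The defect `μ (D ∩ B) - μ D * μ B` is bounded on the whole future once it is bounded for events
depending on finitely many coordinates. -/
lemma measure_inter_le_of_forall_finite {E : Type*} [MeasurableSpace E] {X : ℕ → Ω → E}
    (hX : ∀ t, Measurable (X t)) {m : ℕ} {D : Set Ω} {r : ℝ≥0∞}
    (h : ∀ (N : ℕ) (G : Set (ℕ → E)), MeasurableSet G →
      (∀ ξ ξ' : ℕ → E, (∀ s, m ≤ s → s < m + N → ξ s = ξ' s) → (ξ ∈ G ↔ ξ' ∈ G)) →
      μ (D ∩ {ω | (fun s => X s ω) ∈ G}) ≤ μ D * μ {ω | (fun s => X s ω) ∈ G} + r)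
    {B : Set Ω} (hB : MeasurableSet[futureSigma X m] B) : μ (D ∩ B) ≤ μ D * μ B + r := by
  let Y : Ω → ℕ → E := fun ω i => X (m + i) ω
  have hY : Measurable Y := measurable_pi_iff.2 fun i => hX (m + i)
  have hle : futureSigma X m ≤ MeasurableSpace.comap Y inferInstance := by
    refine iSup₂_le fun j hj => ?_
    have : X j = (fun ξ : ℕ → E => ξ (j - m)) ∘ Y := by
      ext ω; simp [Y, Nat.add_sub_cancel' hj]
    rw [this, ← MeasurableSpace.comap_comp]
    exact MeasurableSpace.comap_mono (measurable_pi_apply (j - m)).comap_le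
  obtain ⟨C, hC, rfl⟩ := hle B hB
  have hdense := Measure.MeasureDense.of_generateFrom_isSetAlgebra_finite (μ.map Y)
    (isSetAlgebra_measurableCylinders (α := fun _ : ℕ => E))
    (generateFrom_measurableCylinders (α := fun _ : ℕ => E)).symm
  refine ENNReal.le_of_forall_pos_le_add fun ε hε _ => ?_
  obtain ⟨C', hC', hCC⟩ := hdense.approx C hC (measure_ne_top _ _) (ε / 2) (by positivity)
  have hC'm : MeasurableSet C' := MeasurableSet.of_mem_measurableCylinders hC'
  obtain ⟨s, S, hS, rfl⟩ := (mem_measurableCylinders _).1 hC'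
  set C' : Set (ℕ → E) := cylinder s S
  rw [Measure.map_apply hY (hC.symmDiff hC'm)] at hCC
  have hG : Measurable fun (ξ : ℕ → E) i => ξ (m + i) :=
    measurable_pi_iff.2 fun i => measurable_pi_apply (m + i)
  -- The cylinder looks at indices up to `s.sup id`, so a window of one more coordinate suffices
  -- after the shift by `m`.
  have key := h (s.sup id + 1) {ξ | (fun i => ξ (m + i)) ∈ C'} (hG hC'm) fun ξ ξ' hξ => by
    simp only [C', Set.mem_ofPred_eq, mem_cylinder]
    have : s.restrict (fun i => ξ (m + i)) = s.restrict (fun i => ξ' (m + i)) := by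
      ext1 i
      have := Finset.le_sup (f := id) i.2
      simp only [id] at this
      exact hξ _ (by omega) (by omega)
    rw [this]
  have e1 : μ (D ∩ Y ⁻¹' C) ≤ μ (D ∩ Y ⁻¹' C') + ENNReal.ofReal (ε / 2) := by
    refine (measure_mono (t := (D ∩ Y ⁻¹' C') ∪ Y ⁻¹' (symmDiff C C')) ?_).trans
      ((measure_union_le _ _).trans (by gcongr))
    rintro ω ⟨hD, hω⟩
    by_cases hω' : Y ω ∈ C'
    · exact Or.inl ⟨hD, hω'⟩
    · exact Or.inr (Or.inl ⟨hω, hω'⟩)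
  have e2 : μ (Y ⁻¹' C') ≤ μ (Y ⁻¹' C) + ENNReal.ofReal (ε / 2) := by
    refine (measure_mono (t := (Y ⁻¹' C) ∪ Y ⁻¹' (symmDiff C C')) ?_).trans
      ((measure_union_le _ _).trans (by gcongr))
    intro ω hω
    by_cases hω' : Y ω ∈ C
    · exact Or.inl hω'
    · exact Or.inr (Or.inr ⟨hω, hω'⟩)
  have hhalf : ENNReal.ofReal (ε / 2) + ENNReal.ofReal (ε / 2) = ε := by
    rw [← ENNReal.ofReal_add (by positivity) (by positivity), add_halves, ENNReal.ofReal_coe_nnreal]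
  calc μ (D ∩ Y ⁻¹' C) ≤ μ (D ∩ Y ⁻¹' C') + ENNReal.ofReal (ε / 2) := e1
    _ ≤ μ D * μ (Y ⁻¹' C') + r + ENNReal.ofReal (ε / 2) := by gcongr; exact key
    _ ≤ μ D * (μ (Y ⁻¹' C) + ENNReal.ofReal (ε / 2)) + r + ENNReal.ofReal (ε / 2) := by gcongr
    _ ≤ (μ D * μ (Y ⁻¹' C) + 1 * ENNReal.ofReal (ε / 2)) + r + ENNReal.ofReal (ε / 2) := by
        rw [mul_add]; gcongr; exact prob_le_one
    _ = μ D * μ (Y ⁻¹' C) + r + (ENNReal.ofReal (ε / 2) + ENNReal.ofReal (ε / 2)) := by ring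
    _ = _ := by rw [hhalf]

end Beta

/-! ### The mixing bound for the model -/

variable {Ω : Type*} {d : ℕ} {A B : Matrix (Fin d) (Fin d) ℝ≥0} {lam : ℕ → Ω → Fin d → ℝ≥0}
  {X : ℕ → Ω → Fin d → ℕ} {Z : ℕ → Ω → Fin d → ℝ≥0} [mΩ : MeasurableSpace Ω] {μ : Measure Ω}
  [IsProbabilityMeasure μ]

lemma IsPoissonINGARCH.lintegral_sqrtDist_counts_le_one (h : IsPoissonINGARCH μ A B lam X Z)
    (hlam : ∀ t, Measurable[history lam X Z t] (lam (t + 1))) (t : ℕ) (j : Fin d) :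
    ∫⁻ ω, (sqrtDist (X (t + 1) ω j) (lam (t + 1) ω j) : ℝ≥0∞) ∂μ ≤ 1 := by
  rw [h.lintegral_counts t (Φ := fun ω x => (sqrtDist (x j) (lam (t + 1) ω j) : ℝ≥0∞)) fun x =>
    ((measurable_const (a := (x j : ℝ≥0))).sqrtDist
      ((measurable_pi_apply j).comp (hlam t))).coe_nnreal_ennreal]
  refine (lintegral_mono fun ω => lintegral_poissonVec_sqrtDist_le_one _ j).trans ?_
  simp

/-- The sum of the coordinatewise square-root distances. -/
def sqrtDistSum (l l' : Fin d → ℝ≥0) : ℝ≥0 := ∑ i, sqrtDist (l i) (l' i)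

lemma dotProduct_sqrtDistVec_le {w l l' : Fin d → ℝ≥0} {q : ℝ≥0} (hq : ∀ i, w i ≤ q) :
    w ⬝ᵥ sqrtDistVec l l' ≤ q * sqrtDistSum l l' := by
  rw [sqrtDistSum, Finset.mul_sum]
  exact Finset.sum_le_sum fun i _ => mul_le_mul_left (hq i) _

lemma sqrtDistSum_comm (l l' : Fin d → ℝ≥0) : sqrtDistSum l l' = sqrtDistSum l' l := by
  simp only [sqrtDistSum, sqrtDist_comm]

/-- The conditional probability of the event given the history is V(λ_{k+1}). The Lipschitz bound is
used twice, from V(λ_{k+1}) to V(c) on `D` and from V(c) to the mean of V(λ_{k+1}), which is the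
unconditional probability. -/
lemma IsPoissonINGARCH.measure_inter_le (h : IsPoissonINGARCH μ A B lam X Z)
    (hlam : ∀ t, Measurable[history lam X Z t] (lam (t + 1)))
    (hrec : ∀ t ω, lam (t + 1) ω
      = A *ᵥ lam t ω + B *ᵥ (fun j => (X t ω j : ℝ≥0)) + Z t ω)
    {k j N : ℕ} {G : Set (ℕ → Fin d → ℕ)} (hG : MeasurableSet G)
    (hGm : ∀ ξ ξ' : ℕ → Fin d → ℕ,
      (∀ s, k + 1 + j ≤ s → s < k + 1 + j + N → ξ s = ξ' s) → (ξ ∈ G ↔ ξ' ∈ G))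
    {q : ℝ≥0} (hq : ∀ i, lipWeight (sqrtMatrixNN A B) N j i ≤ q) (c : Fin d → ℝ≥0)
    {D : Set Ω} (hD : MeasurableSet[history lam X Z k] D) :
    μ (D ∩ {ω | (fun s => X s ω) ∈ G}) ≤ μ D * μ {ω | (fun s => X s ω) ∈ G}
      + ∫⁻ ω in D, (((q * sqrtDistSum (lam (k + 1) ω) c : ℝ≥0) : ℝ≥0∞)
        + ∫⁻ ω', ((q * sqrtDistSum (lam (k + 1) ω') c : ℝ≥0) : ℝ≥0∞) ∂μ) ∂μ := by
  have hprob : ∀ s, IsProbabilityMeasure (μ.map (Z s)) := fun s =>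
    Measure.isProbabilityMeasure_map (h.measurable_Z s).aemeasurable
  have hD' := h.history_le k D hD
  have hSG : MeasurableSet {ω | (fun s => X s ω) ∈ G} :=
    (measurable_pi_iff.2 fun s => h.measurable_X s : Measurable fun ω s => X s ω) hG
  set SG := {ω | (fun s => X s ω) ∈ G}
  set g : (ℕ → Fin d → ℕ) → ℝ≥0∞ := G.indicator 1 with hg
  have hgmeas : Measurable g := measurable_one.indicator hG
  have hg1 : ∀ ξ, g ξ ≤ 1 := fun ξ => Set.indicator_le_self' (fun _ _ => zero_le) ξ
  have hgm' : ∀ ξ ξ' : ℕ → Fin d → ℕ,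
      (∀ s, k + 1 + j ≤ s → s < k + 1 + j + N → ξ s = ξ' s) → g ξ = g ξ' := by
    intro ξ ξ' hξ
    have := hGm ξ ξ' hξ
    by_cases hx : ξ ∈ G
    · simp [hg, hx, this.1 hx]
    · have hx' : ξ' ∉ G := fun hx' => hx (this.2 hx')
      simp [hg, hx, hx']
  have hgm : ∀ ξ ξ' : ℕ → Fin d → ℕ, (∀ s ≥ k + 1 + j, ξ s = ξ' s) → g ξ = g ξ' :=
    fun ξ ξ' hξ => hgm' ξ ξ' fun s hs _ => hξ s hs
  set V := condValue A B (fun s => μ.map (Z s)) g (N + j) (k + 1) 0 with hV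
  have hcontr := condValue_le_add_contraction (A := A) (B := B) (ν := fun s => μ.map (Z s))
    hg1 (k + 1 + j) hgm N j (k + 1) rfl 0
  have hcost : ∀ l l', V l ≤ V l' + ((q * sqrtDistSum l l' : ℝ≥0) : ℝ≥0∞) := fun l l' =>
    (hcontr l l').trans (by gcongr; exact dotProduct_sqrtDistVec_le hq)
  have hVm : Measurable fun ω => V (lam (k + 1) ω) :=
    (measurable_condValue hgmeas (N + j) (k + 1)).comp
      ((measurable_const (a := (0 : ℕ → Fin d → ℕ))).prodMk (h.measurable_lam (k + 1)))
  have hcm : Measurable fun ω => ((q * sqrtDistSum (lam (k + 1) ω) c : ℝ≥0) : ℝ≥0∞) := by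
    refine Measurable.coe_nnreal_ennreal (Measurable.const_mul ?_ q)
    exact Finset.measurable_sum _ fun i _ =>
      ((measurable_pi_apply i).comp (h.measurable_lam (k + 1))).sqrtDist measurable_const
  have hrepr : ∀ u : Ω → ℝ≥0∞, Measurable[history lam X Z k] u →
      ∫⁻ ω, u ω * SG.indicator 1 ω ∂μ = ∫⁻ ω, u ω * V (lam (k + 1) ω) ∂μ := by
    intro u hu
    have := h.lintegral_mul_truncPath hlam hrec hgmeas (N + j) k u hu
    refine Eq.trans (lintegral_congr fun ω => ?_) (this.trans (lintegral_congr fun ω => ?_))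
    · rw [hgm' (truncPath X (k + 1 + (N + j)) ω) (fun s => X s ω) fun s _ hs => by
        have : s < k + 1 + (N + j) := by omega
        simp [truncPath, this]]
      rfl
    · rw [hV, condValue_congr (k + 1 + j) hgm (N + j) (k + 1) (truncPath X (k + 1) ω) 0
        (lam (k + 1) ω) fun s hs => by
          have : ¬ s < k + 1 := by omega
          simp [truncPath, this]]
  -- The weights 1_D and 1 give the joint and the unconditional probability from one representation.
  have hrD := hrepr (D.indicator 1) (Measurable.indicator (f := 1) (measurable_const (a := 1)) hD)
  have hr1 := hrepr 1 (measurable_const (a := 1))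
  have e1 : ∀ ω, D.indicator (1 : Ω → ℝ≥0∞) ω * SG.indicator 1 ω = (D ∩ SG).indicator 1 ω := by
    intro ω
    rw [← Set.inter_indicator_mul]
    simp only [Pi.one_apply, mul_one]
    rfl
  have e2 : ∀ ω, D.indicator (1 : Ω → ℝ≥0∞) ω * V (lam (k + 1) ω)
      = D.indicator (fun ω => V (lam (k + 1) ω)) ω := by
    intro ω
    by_cases hω : ω ∈ D <;> simp [hω]
  simp only [e1, e2] at hrD
  rw [lintegral_indicator_one (hD'.inter hSG), lintegral_indicator hD'] at hrD
  simp only [Pi.one_apply, one_mul] at hr1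
  rw [lintegral_indicator_one hSG] at hr1
  have hVc : V c ≤ μ SG + ∫⁻ ω, ((q * sqrtDistSum (lam (k + 1) ω) c : ℝ≥0) : ℝ≥0∞) ∂μ := by
    rw [hr1, ← lintegral_add_left hVm]
    have : V c = ∫⁻ _, V c ∂μ := by simp
    rw [this]
    refine lintegral_mono fun ω => ?_
    rw [sqrtDistSum_comm]
    exact hcost _ _
  rw [hrD, mul_comm, ← setLIntegral_const, ← lintegral_add_left measurable_const]
  refine lintegral_mono fun ω => ((hcost _ c).trans (add_le_add_left hVc _)).trans (le_of_eq ?_)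
  ring

lemma futureSigma_le {E : Type*} [MeasurableSpace E] {Y : ℕ → Ω → E}
    (hY : ∀ t, Measurable (Y t)) (k : ℕ) : futureSigma Y k ≤ mΩ :=
  iSup₂_le fun j _ => (hY j).comap_le

lemma IsPoissonINGARCH.betaAt_succ_le (h : IsPoissonINGARCH μ A B lam X Z)
    (hlam : ∀ t, Measurable[history lam X Z t] (lam (t + 1)))
    (hrec : ∀ t ω, lam (t + 1) ω
      = A *ᵥ lam t ω + B *ᵥ (fun j => (X t ω j : ℝ≥0)) + Z t ω)
    {k j : ℕ} {q K : ℝ≥0} (hq : ∀ N i, lipWeight (sqrtMatrixNN A B) N j i ≤ q)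
    {c : Fin d → ℝ≥0} (hc : ∀ i, ∫⁻ ω, (sqrtDist (lam (k + 1) ω i) (c i) : ℝ≥0∞) ∂μ ≤ K) :
    betaAt μ X k (j + 1) ≤ (2 * q * d * K : ℝ≥0) := by
  have hm : ∀ i, Measurable fun ω => sqrtDist (lam (k + 1) ω i) (c i) := fun i =>
    ((measurable_pi_apply i).comp (h.measurable_lam (k + 1))).sqrtDist measurable_const
  have hcm : Measurable fun ω => ((q * sqrtDistSum (lam (k + 1) ω) c : ℝ≥0) : ℝ≥0∞) :=
    Measurable.coe_nnreal_ennreal (Measurable.const_mul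
      (Finset.measurable_sum _ fun i _ => hm i) q)
  have hI : ∫⁻ ω, ((q * sqrtDistSum (lam (k + 1) ω) c : ℝ≥0) : ℝ≥0∞) ∂μ ≤ (q * (d * K) : ℝ≥0) := by
    simp only [sqrtDistSum]
    push_cast
    rw [lintegral_const_mul _ (Finset.measurable_sum _ fun i _ => (hm i).coe_nnreal_ennreal),
      lintegral_finsetSum _ fun i _ => (hm i).coe_nnreal_ennreal]
    gcongr
    refine (Finset.sum_le_sum fun i _ => hc i).trans (le_of_eq ?_)
    simp
  have htot : ∫⁻ ω, (((q * sqrtDistSum (lam (k + 1) ω) c : ℝ≥0) : ℝ≥0∞)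
      + ∫⁻ ω', ((q * sqrtDistSum (lam (k + 1) ω') c : ℝ≥0) : ℝ≥0∞) ∂μ) ∂μ
      ≤ (2 * q * d * K : ℝ≥0) := by
    rw [lintegral_add_left hcm, lintegral_const, measure_univ, mul_one]
    refine (add_le_add hI hI).trans (le_of_eq ?_)
    rw [← ENNReal.coe_add]
    congr 1
    ring
  refine (betaCoeff_le_lintegral (pastSigma_le h.measurable_X k)
    (futureSigma_le h.measurable_X _) (hcm.add_const _)
    (htot.trans_lt ENNReal.coe_lt_top).ne fun S D hS hD => ?_).trans htot
  refine measure_inter_le_of_forall_finite h.measurable_X (fun N G hG hGm => ?_) hS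
  -- λ_{k+1} is already fixed by the history, so a gap of `j + 1` leaves only `j` contracting steps.
  have e : k + (j + 1) = k + 1 + j := by ring
  rw [e] at hGm
  exact h.measure_inter_le hlam hrec hG hGm (hq N) c (pastSigma_le_history lam X Z k D hD)

end

/-! ### Assembly: geometric decay and absolute regularity. -/

noncomputable section

section Main

variable {Ω : Type*} {d : ℕ} {A B : Matrix (Fin d) (Fin d) ℝ≥0} {lam : ℕ → Ω → Fin d → ℝ≥0}
  {X : ℕ → Ω → Fin d → ℕ} {Z : ℕ → Ω → Fin d → ℝ≥0} [mΩ : MeasurableSpace Ω] {μ : Measure Ω}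

lemma lintegral_sqrtDist_eq {f g : Ω → ℝ≥0}
    (h : Integrable (fun ω => √(f ω : ℝ) - √(g ω : ℝ)) μ) :
    ∫⁻ ω, (sqrtDist (f ω) (g ω) : ℝ≥0∞) ∂μ
      = ENNReal.ofReal (∫ ω, |√(f ω : ℝ) - √(g ω : ℝ)| ∂μ) := by
  rw [ofReal_integral_eq_lintegral_ofReal h.abs (ae_of_all _ fun ω => abs_nonneg _)]
  simp only [← coe_sqrtDist, ENNReal.ofReal_coe_nnreal]

variable [IsProbabilityMeasure μ]

/-- Geometric decay of the coefficients of absolute regularity, for rates below one. -/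
lemma IsPoissonINGARCH.exists_betaMixing_le (h : IsPoissonINGARCH μ A B lam X Z)
    (hlam : ∀ i, Integrable (fun ω => √(lam 0 ω i : ℝ)) μ)
    (hX : ∀ i, Integrable (fun ω => √(X 0 ω i : ℝ)) μ)
    (hZint : ∀ t i, Integrable (fun ω => √(Z t ω i : ℝ)) μ)
    (hZ : ∀ i, BddAbove (Set.range fun t : ℕ =>
      ∫ ω, |√(Z t ω i : ℝ) - ∫ ω', √(Z t ω' i : ℝ) ∂μ| ∂μ))
    {κ : ℝ≥0} (hκ : κ < 1) (hρ : rhoSqrt A B < κ) :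
    ∃ K : ℝ≥0, ∀ n : ℕ, betaMixing μ X n ≤ (K : ℝ≥0∞) * (κ : ℝ≥0∞) ^ n := by
  have hκ0 : κ ≠ 0 := (ENNReal.coe_pos.1 (zero_le.trans_lt hρ)).ne'
  obtain ⟨C, hC⟩ := exists_sqrtMatrixNN_pow_le hρ
  have hr := h.to_recIntensity
  set lam' := recIntensity A B (lam 0) X Z
  have hlam' : ∀ t, Measurable[history lam' X Z t] (lam' (t + 1)) := fun t =>
    measurable_history_recIntensity (lam := lam) t
  have hrec : ∀ t ω, lam' (t + 1) ω
      = A *ᵥ lam' t ω + B *ᵥ (fun j => (X t ω j : ℝ≥0)) + Z t ω := fun _ _ => rfl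
  choose ζ hζ using hZ
  -- Chosen so that √z = E√Z, which turns the assumption on the covariates into a bound on their
  -- mean distance from `z`.
  let z : ℕ → Fin d → ℝ≥0 := fun t i => (∫ ω, √(Z t ω i : ℝ) ∂μ).toNNReal ^ 2
  have hz : ∀ t i, √(z t i : ℝ) = ∫ ω, √(Z t ω i : ℝ) ∂μ := by
    intro t i
    have h0 : 0 ≤ ∫ ω, √(Z t ω i : ℝ) ∂μ := integral_nonneg fun ω => Real.sqrt_nonneg _
    simp only [z]
    rw [NNReal.coe_pow, Real.sqrt_sq (NNReal.coe_nonneg _), Real.coe_toNNReal _ h0]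
  -- The 1 serves the times `t ≥ 1`, when the count is conditionally Poisson; the integral serves `t
  -- = 0`, where no such law is assumed.
  have hcounts : ∀ t j, ∫⁻ ω, (sqrtDist (X t ω j) (lam' t ω j) : ℝ≥0∞) ∂μ
      ≤ (1 + (∫ ω, |√(((X 0 ω j : ℕ) : ℝ≥0) : ℝ) - √(lam 0 ω j : ℝ)| ∂μ).toNNReal : ℝ≥0) := by
    intro t j
    rcases t with _ | t
    · change ∫⁻ ω, (sqrtDist (X 0 ω j) (lam 0 ω j) : ℝ≥0∞) ∂μ ≤ _
      have hi : Integrable (fun ω => √(X 0 ω j : ℝ) - √(lam 0 ω j : ℝ)) μ := (hX j).sub (hlam j)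
      rw [lintegral_sqrtDist_eq (by simpa using hi)]
      exact ENNReal.coe_le_coe.2 le_add_self
    · refine (hr.lintegral_sqrtDist_counts_le_one hlam' t j).trans ?_
      rw [← ENNReal.coe_one, ENNReal.coe_le_coe]
      exact le_self_add
  have hinit : ∀ j, ∫⁻ ω, (sqrtDist (lam' 0 ω j) 0 : ℝ≥0∞) ∂μ
      ≤ ((∫ ω, |√(lam 0 ω j : ℝ) - √((0 : ℝ≥0) : ℝ)| ∂μ).toNNReal : ℝ≥0) := fun j =>
    (lintegral_sqrtDist_eq (f := fun ω => lam 0 ω j) (g := fun _ => 0)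
      (by simpa using hlam j)).le
  have hcov : ∀ t j, ∫⁻ ω, (sqrtDist (Z t ω j) (z t j) : ℝ≥0∞) ∂μ ≤ (ζ j).toNNReal := by
    intro t j
    rw [lintegral_sqrtDist_eq (by rw [hz]; exact (hZint t j).sub (integrable_const _))]
    simp only [hz]
    exact ENNReal.ofReal_le_ofReal (hζ j ⟨t, rfl⟩)
  obtain ⟨K, hK⟩ := exists_bound_lintegral_sqrtDist_centre h.measurable_X h.measurable_Z
    hr.measurable_lam hrec hκ hC hcounts hinit hcov
  have hK1 : ∀ k j, betaAt μ X k (j + 1)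
      ≤ (2 * (d * 2 * C * (1 - κ)⁻¹ * κ ^ j) * d * K : ℝ≥0) := fun k j =>
    hr.betaAt_succ_le hlam' hrec (fun N i => lipWeight_le hκ hC N j i) fun i => hK (k + 1) i
  -- The summand 1 covers `n = 0`, where β ≤ 1; the division by `κ` compensates for the decay κ^j at
  -- `n = j + 1`.
  refine ⟨1 + 2 * (d * 2 * C * (1 - κ)⁻¹) * d * K / κ, fun n => iSup_le fun k => ?_⟩
  rw [← ENNReal.coe_pow, ← ENNReal.coe_mul]
  rcases n with _ | j
  · refine (betaCoeff_le_one (pastSigma_le h.measurable_X k)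
      (futureSigma_le h.measurable_X _)).trans ?_
    rw [pow_zero, mul_one, ← ENNReal.coe_one, ENNReal.coe_le_coe]
    exact le_self_add
  · refine (hK1 k j).trans (ENNReal.coe_le_coe.2 ?_)
    calc _ = 2 * (d * 2 * C * (1 - κ)⁻¹) * d * K / κ * κ ^ (j + 1) := by
          rw [pow_succ]; field_simp
      _ ≤ _ := by gcongr; exact le_add_self

end Main

end

theorem theorem1 {Ω : Type*} [MeasurableSpace Ω] (μ : Measure Ω) [IsProbabilityMeasure μ]
    (d : ℕ) (A B : Matrix (Fin d) (Fin d) ℝ≥0)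
    (lam : ℕ → Ω → Fin d → ℝ≥0) (X : ℕ → Ω → Fin d → ℕ) (Z : ℕ → Ω → Fin d → ℝ≥0)
    (hmodel : IsPoissonINGARCH μ A B lam X Z)
    (hrho : rhoSqrt A B < 1)
    (hlam : ∀ i, Integrable (fun ω => √(lam 0 ω i : ℝ)) μ)
    (hX : ∀ i, Integrable (fun ω => √(X 0 ω i : ℝ)) μ)
    (hZint : ∀ t i, Integrable (fun ω => √(Z t ω i : ℝ)) μ)
    (hZ : ∀ i, BddAbove (Set.range fun t : ℕ =>
      ∫ ω, |√(Z t ω i : ℝ) - ∫ ω', √(Z t ω' i : ℝ) ∂μ| ∂μ)) :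
    AbsolutelyRegular μ X ∧
      ∀ κ : ℝ≥0, rhoSqrt A B < (κ : ℝ≥0∞) →
        ∃ K : ℝ≥0, ∀ n : ℕ, betaMixing μ X n ≤ (K : ℝ≥0∞) * (κ : ℝ≥0∞) ^ n := by
  have hdecay : ∀ κ : ℝ≥0, rhoSqrt A B < (κ : ℝ≥0∞) →
      ∃ κ' : ℝ≥0, κ' < 1 ∧ κ' ≤ κ ∧
        ∃ K : ℝ≥0, ∀ n : ℕ, betaMixing μ X n ≤ (K : ℝ≥0∞) * (κ' : ℝ≥0∞) ^ n := by
    intro κ hκ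
    -- The geometric series need a rate below 1, whereas `κ` may be larger.
    obtain ⟨κ', h1, h2⟩ := ENNReal.lt_iff_exists_nnreal_btwn.1 (lt_min hκ hrho)
    have hκ'1 : κ' < 1 := by exact_mod_cast h2.trans_le (min_le_right _ _)
    exact ⟨κ', hκ'1, by exact_mod_cast (h2.trans_le (min_le_left _ _)).le,
      hmodel.exists_betaMixing_le hlam hX hZint hZ hκ'1 h1⟩
  refine ⟨?_, fun κ hκ => ?_⟩
  · obtain ⟨κ, hκ1, -, K, hK⟩ := hdecay 1 (by simpa using hrho)
    have hlim : Tendsto (fun n : ℕ => (K : ℝ≥0∞) * (κ : ℝ≥0∞) ^ n) atTop (𝓝 0) := by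
      have := ENNReal.Tendsto.const_mul (a := (K : ℝ≥0∞))
        (ENNReal.tendsto_pow_atTop_nhds_zero_of_lt_one (r := (κ : ℝ≥0∞)) (by exact_mod_cast hκ1))
        (Or.inr ENNReal.coe_ne_top)
      simpa using this
    exact tendsto_of_tendsto_of_tendsto_of_le_of_le tendsto_const_nhds hlim
      (fun _ => zero_le) hK
  · obtain ⟨κ', -, hle, K, hK⟩ := hdecay κ hκ
    exact ⟨K, fun n => (hK n).trans (by gcongr)⟩
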